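/- **Conventions.** $\langle x,y\rangle=\sum_i x_i\overline{y_i}$ is the standard Hermitian inner product of $\mathbf C^n$, $*$ is the conjugate transpose, $\dim$ is the complex dimension, $\mathrm{Gr}(M)=\{(x,Mx)\}$ is the graph of $M$. For a self-adjoint matrix $A$ and a subspace $S$, $A|_S$ is the Hermitian form $\langle Ax,y\rangle$ restricted to $S$, $\ker(A|_S)=\{x\in S:\langle Ax,y\rangle=0\text{ for all }y\in S\}$, and $m^+(A|_S)$ is its Morse positive index (the maximal dimension of a subspace of $S$ on which it is positive definite). **Maslov index.** Let $(H,\omega)$ be a finite-dimensional complex symplectic space ($\omega$ linear in the first and conjugate linear in the second variable, skew-Hermitian, non-degenerate). A symplectic splitting is an $\omega$-orthogonal decomposition $H=H^+\oplus H^-$ such that $-\sqrt{-1}\,\omega$ is positive definite on $H^+$ and negative definite on $H^-$. For continuous paths $\lambda_s,\mu_s$ ($a\le s\le b$) of Lagrangian subspaces of $H$, write $\lambda_s$ and $\mu_s$ as the graphs of the linear isomorphisms $U_s,V_s:H^+\to H^-$ (which satisfy $\omega(U_sx,U_sy)=-\omega(x,y)$, and likewise for $V_s$). The spectrum of $U_sV_s^{-1}$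 lies in the unit circle, and $\mathrm{Mas}\{\lambda_s,\mu_s\}=-\mathrm{sf}_\ell\{U_sV_s^{-1}\}$, where $\mathrm{sf}_\ell$ is the spectral flow through $1$, i.e. the net number of eigenvalues, with multiplicity, passing from the open lower side $\{e^{i\varphi}:\varphi<0\}$ to the non-negative side $\{e^{i\varphi}:\varphi\ge0\}$ near $1$: it equals $\sum_j\bigl(N_j(s_j)-N_j(s_{j+1})\bigr)$ for any partition $a=s_0<\dots<s_m=b$ and angles $\theta_j\in(0,\pi)$ such that $e^{\pm i\theta_j}$ is not an eigenvalue of $U_sV_s^{-1}$ for $s\in[s_j,s_{j+1}]$, with $N_j(s)$ the number of eigenvalues of $U_sV_s^{-1}$ in $\{e^{i\varphi}:-\theta_j<\varphi<0\}$. For a path $\gamma$ of matrices preserving $\omega(x,y)=\langle Jx,y\rangle$ on $X=\mathbf C^N$ and a Lagrangian subspace $W$ of $(X\oplus X,(-\omega)\oplus\omega)$, the Maslov-type index is $i_W(\gamma)=\mathrm{Mas}\{\mathrm{Gr}(\gamma(t)),W\}$. **Theorem 2.2.** Let $K\in\mathrm{GL}(n,\mathbf C)$, $T>0$, $J_K=\begin{pmatrix}0&-K^*\\K&0\end{pmatrix}$,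 and let $$\gamma(t)=\begin{pmatrix}M_{1,1}(t)&0\\M_{2,1}(t)&M_{2,2}(t)\end{pmatrix},\qquad 0\le t\le T,$$ be a continuous path of $2n\times2n$ complex matrices such that, for each $t$, $M_{2,2}(t)^*KM_{1,1}(t)=K$ and $M_{1,1}(t)^*K^*M_{2,1}(t)$ is self-adjoint; thus $\gamma(t)^*J_K\gamma(t)=J_K$. Let $R\subset\mathbf C^{2n}=\mathbf C^n\oplus\mathbf C^n$ be a linear subspace and put $$R^K=\{(x_1,x_2)\in\mathbf C^{2n}:\langle Kx_1,y_1\rangle-\langle Kx_2,y_2\rangle=0\text{ for all }(y_1,y_2)\in R\},$$ $$W_K(R)=\{(x_1,x_2,x_3,x_4)\in\mathbf C^{4n}:(x_1,x_3)\in R^K,\ (x_2,x_4)\in R\},$$ $$S(t)=\{x\in\mathbf C^n:(x,M_{1,1}(t)x)\in R^K\}.$$ Then, for every $t\in[0,T]$, $$\dim(\mathrm{Gr}(\gamma(t))\cap W_K(R))=\dim\ker\bigl((M_{1,1}(t)^*K^*M_{2,1}(t))|_{S(t)}\bigr)+\dim S(t)+\dim(\mathrm{Gr}(I_n)\cap R)-\dim(\mathrm{Gr}(I_n)\cap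 R^K),$$ and the Maslov-type index of $\gamma$ with respect to $J_K$ and $W_K(R)$ is well defined and equals $$i_{W_K(R)}(\gamma)=m^+\bigl((M_{1,1}(T)^*K^*M_{2,1}(T))|_{S(T)}\bigr)-m^+\bigl((M_{1,1}(0)^*K^*M_{2,1}(0))|_{S(0)}\bigr)+\dim S(0)-\dim S(T).$$ -/

import Mathlib

namespace MaslovType

open Complex

/-! ### Spectral flow of unitary paths through `1` -/

section SpectralFlow

variable {E : Type*} [AddCommGroup E] [Module ℂ E]

/-- The range of the spectral (Riesz) projection `P(A, N)` of an endomorphism `A` of a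
finite-dimensional space: the sum of the generalized eigenspaces of `A` with eigenvalue in `N`.
Its dimension is the number of eigenvalues of `A` in `N`, with algebraic multiplicity. -/
def spectralSubspace (A : Module.End ℂ E) (N : Set ℂ) : Submodule ℂ E :=
  ⨆ z ∈ N, A.maxGenEigenspace z

/-- The open arc of the unit circle of angle `θ` on the negative (lower) side of `1`. -/
def lowerArc (θ : ℝ) : Set ℂ :=
  {z | ∃ φ : ℝ, -θ < φ ∧ φ < 0 ∧ z = exp (φ * I)}

/-- `HasSpectralFlow a b A k`: the spectral flow of the continuous path `A s`, `a ≤ s ≤ b`, of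
endomorphisms with spectrum in the unit circle, through `ℓ = (1 - ε, 1 + ε)` with upward
co-orientation, is `k`. There are a partition `a = s 0 < ⋯ < s m = b` and angles `θ j ∈ (0, π)`
such that `exp (± i θ j)` is not an eigenvalue of `A u` for `u ∈ [s j, s (j + 1)]`, and `k` is the
sum over `j` of the number of eigenvalues of `A (s j)` minus the number of eigenvalues of
`A (s (j + 1))` in the arc `{exp (i φ) | -θ j < φ < 0}`. Thus `k` counts the eigenvalues passing
through `1` from the strictly negative (lower) side to the non-negative side. -/
def HasSpectralFlow (a b : ℝ) (A : ℝ → Module.End ℂ E) (k : ℤ) : Prop :=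
  ∃ (m : ℕ) (s θ : ℕ → ℝ),
    s 0 = a ∧ s m = b ∧ (∀ j < m, s j < s (j + 1)) ∧
    (∀ j < m, 0 < θ j ∧ θ j < Real.pi) ∧
    (∀ j < m, ∀ u ∈ Set.Icc (s j) (s (j + 1)),
      exp (θ j * I) ∉ spectrum ℂ (A u) ∧ exp (-(θ j * I)) ∉ spectrum ℂ (A u)) ∧
    k = ∑ j ∈ Finset.range m,
      ((Module.finrank ℂ (spectralSubspace (A (s j)) (lowerArc (θ j))) : ℤ)
        - (Module.finrank ℂ (spectralSubspace (A (s (j + 1))) (lowerArc (θ j))) : ℤ))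

end SpectralFlow

/-! ### The Maslov index of two paths of Lagrangian subspaces -/

section Maslov

variable {H : Type*} [AddCommGroup H] [Module ℂ H]

/-- A symplectic splitting `H = H⁺ ⊕ H⁻`: the two spaces are complementary and `ω`-orthogonal,
and the Hermitian form `-i ω` is positive definite on `H⁺` and negative definite on `H⁻`.
(For a skew-Hermitian `ω` the number `-i ω(x, x)` is real.) -/
structure IsSymplecticSplitting (ω : H →ₗ[ℂ] H →ₗ⋆[ℂ] ℂ) (Hp Hm : Submodule ℂ H) : Prop where
  isCompl : IsCompl Hp Hm
  orthogonal : ∀ x ∈ Hp, ∀ y ∈ Hm, ω x y = 0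
  pos : ∀ x ∈ Hp, x ≠ 0 → 0 < (-I * ω x x).re
  neg : ∀ x ∈ Hm, x ≠ 0 → (-I * ω x x).re < 0

/-- `U : H⁺ → H⁻` is an invertible map with `ω(Ux, Uy) = -ω(x, y)` on `H⁺`, and its graph
`{x + U x | x ∈ H⁺}` is the (Lagrangian) subspace `L`. -/
def Generates (ω : H →ₗ[ℂ] H →ₗ⋆[ℂ] ℂ) {Hp Hm : Submodule ℂ H} (U : Hp ≃ₗ[ℂ] Hm)
    (L : Submodule ℂ H) : Prop :=
  (∀ x y : Hp, ω (U x) (U y) = -ω x y) ∧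
    ∀ z : H, z ∈ L ↔ ∃ x : Hp, z = (x : H) + (U x : H)

/-- `HasMaslovIndex ω a b L M k`: the Maslov index of the continuous paths `L s`, `M s`,
`a ≤ s ≤ b`, of Lagrangian subspaces of the finite-dimensional complex symplectic space `(H, ω)`
is `k`. With respect to a symplectic splitting, `L s` and `M s` are the graphs of `U s` and `V s`,
and `k` is minus the spectral flow through `1` of the path `(U s) ∘ (V s)⁻¹` on `H⁻`. -/
def HasMaslovIndex (ω : H →ₗ[ℂ] H →ₗ⋆[ℂ] ℂ) (a b : ℝ) (L M : ℝ → Submodule ℂ H) (k : ℤ) : Prop :=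
  ∃ (Hp Hm : Submodule ℂ H) (U V : ℝ → (Hp ≃ₗ[ℂ] Hm)),
    IsSymplecticSplitting ω Hp Hm ∧
    (∀ s ∈ Set.Icc a b, Generates ω (U s) (L s) ∧ Generates ω (V s) (M s)) ∧
    HasSpectralFlow a b
      (fun s => (U s).toLinearMap ∘ₗ (V s).symm.toLinearMap : ℝ → Module.End ℂ Hm) (-k)

end Maslov

/-! ### Forms given by matrices, and the Maslov-type index -/

section Matrices

variable {ι : Type*} [Fintype ι]

/-- The sesquilinear form `(x, y) ↦ ⟨A x, y⟩`, where `⟨x, y⟩ = ∑ i, x i * conj (y i)` is the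
standard Hermitian inner product of `ℂ^ι`, linear in `x` and conjugate linear in `y`. -/
def form (A : Matrix ι ι ℂ) : (ι → ℂ) →ₗ[ℂ] (ι → ℂ) →ₗ⋆[ℂ] ℂ :=
  LinearMap.mk₂'ₛₗ (RingHom.id ℂ) (starRingEnd ℂ)
    (fun x y => (A.mulVec x) ⬝ᵥ (star y))
    (fun x x' y => by simp [Matrix.mulVec_add, add_dotProduct])
    (fun c x y => by simp [Matrix.mulVec_smul])
    (fun x y y' => by simp [dotProduct_add])
    (fun c x y => by simp)

/-- The form `(-ω) ⊕ ω` on `X ⊕ X`, where `ω(x, y) = ⟨J x, y⟩` and `X = ℂ^ι`. -/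
def graphForm (J : Matrix ι ι ℂ) :
    ((ι → ℂ) × (ι → ℂ)) →ₗ[ℂ] ((ι → ℂ) × (ι → ℂ)) →ₗ⋆[ℂ] ℂ :=
  LinearMap.mk₂'ₛₗ (RingHom.id ℂ) (starRingEnd ℂ)
    (fun z w => -form J z.1 w.1 + form J z.2 w.2)
    (fun z z' w => by simp; ring)
    (fun c z w => by simp; ring)
    (fun z w w' => by simp; ring)
    (fun c z w => by simp; ring)

/-- The graph `{(x, M x)}` of a matrix. -/
def Gr (M : Matrix ι ι ℂ) : Submodule ℂ ((ι → ℂ) × (ι → ℂ)) :=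
  M.mulVecLin.graph

/-- The Maslov-type index `i_W(γ)` of a continuous path `γ t`, `a ≤ t ≤ b`, of matrices with
`γ(t)ᴴ J γ(t) = J`, with respect to a Lagrangian subspace `W` of `(X ⊕ X, (-ω) ⊕ ω)`, is `k`:
the Maslov index of the path `Gr (γ t)` and the constant path `W` is `k`. -/
def HasMaslovTypeIndex (J : Matrix ι ι ℂ) (W : Submodule ℂ ((ι → ℂ) × (ι → ℂ))) (a b : ℝ)
    (γ : ℝ → Matrix ι ι ℂ) (k : ℤ) : Prop :=
  HasMaslovIndex (graphForm J) a b (fun t => Gr (γ t)) (fun _ => W) k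

/-- The kernel of the restriction to `S` of the form `⟨A x, y⟩`. -/
def formKer (A : Matrix ι ι ℂ) (S : Submodule ℂ (ι → ℂ)) : Submodule ℂ (ι → ℂ) where
  carrier := {x | x ∈ S ∧ ∀ y ∈ S, form A x y = 0}
  add_mem' := fun hx hy =>
    ⟨S.add_mem hx.1 hy.1, fun z hz => by simp [hx.2 z hz, hy.2 z hz]⟩
  zero_mem' := ⟨S.zero_mem, fun z _ => by simp⟩
  smul_mem' := fun c _ hx => ⟨S.smul_mem c hx.1, fun z hz => by simp [hx.2 z hz]⟩

/-- The Morse positive index `m⁺` of the restriction to `S` of the form `⟨A x, y⟩` (`A`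
self-adjoint): the maximal dimension of a subspace of `S` on which the form is positive
definite. -/
noncomputable def morsePos (A : Matrix ι ι ℂ) (S : Submodule ℂ (ι → ℂ)) : ℕ :=
  sSup {d | ∃ V : Submodule ℂ (ι → ℂ), V ≤ S ∧ (∀ x ∈ V, x ≠ 0 → 0 < (form A x x).re) ∧
    Module.finrank ℂ V = d}

end Matrices

/-! ### The objects attached to `K` and `R` -/

section Boundary

variable {n : ℕ}

/-- `J_K = (0, -K*; K, 0)`. -/
def JK (K : Matrix (Fin n) (Fin n) ℂ) : Matrix (Fin n ⊕ Fin n) (Fin n ⊕ Fin n) ℂ :=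
  Matrix.fromBlocks 0 (-K.conjTranspose) K 0

/-- `R^K = {(x₁, x₂) | ⟨K x₁, y₁⟩ - ⟨K x₂, y₂⟩ = 0 for all (y₁, y₂) ∈ R}`. -/
def RK (K : Matrix (Fin n) (Fin n) ℂ) (R : Submodule ℂ ((Fin n → ℂ) × (Fin n → ℂ))) :
    Submodule ℂ ((Fin n → ℂ) × (Fin n → ℂ)) where
  carrier := {x | ∀ y ∈ R, form K x.1 y.1 - form K x.2 y.2 = 0}
  add_mem' := fun {x x'} hx hx' y hy => by
    have h := hx y hy
    have h' := hx' y hy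
    simp only [Prod.fst_add, Prod.snd_add, map_add, LinearMap.add_apply]
    linear_combination h + h'
  zero_mem' := fun y _ => by simp
  smul_mem' := fun c x hx y hy => by
    have h := hx y hy
    simp only [Prod.smul_fst, Prod.smul_snd, map_smul, LinearMap.smul_apply, smul_eq_mul]
    linear_combination c * h

/-- `W_K(R) = {(x₁, x₂, x₃, x₄) | (x₁, x₃) ∈ R^K, (x₂, x₄) ∈ R}`, where `(x₁, x₂)` is the first
and `(x₃, x₄)` the second component of `ℂ²ⁿ ⊕ ℂ²ⁿ`. -/
def WK (K : Matrix (Fin n) (Fin n) ℂ) (R : Submodule ℂ ((Fin n → ℂ) × (Fin n → ℂ))) :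
    Submodule ℂ ((Fin n ⊕ Fin n → ℂ) × (Fin n ⊕ Fin n → ℂ)) :=
  (RK K R).comap ((LinearMap.funLeft ℂ ℂ Sum.inl).prodMap (LinearMap.funLeft ℂ ℂ Sum.inl)) ⊓
    R.comap ((LinearMap.funLeft ℂ ℂ Sum.inr).prodMap (LinearMap.funLeft ℂ ℂ Sum.inr))

theorem mem_WK (K : Matrix (Fin n) (Fin n) ℂ) (R : Submodule ℂ ((Fin n → ℂ) × (Fin n → ℂ)))
    (z : (Fin n ⊕ Fin n → ℂ) × (Fin n ⊕ Fin n → ℂ)) :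
    z ∈ WK K R ↔
      (z.1 ∘ Sum.inl, z.2 ∘ Sum.inl) ∈ RK K R ∧ (z.1 ∘ Sum.inr, z.2 ∘ Sum.inr) ∈ R :=
  Iff.rfl

/-- `{x ∈ ℂⁿ | (x, M x) ∈ R^K}`; for `M = M₁₁(t)` this is `S(t)`. -/
def SK (K : Matrix (Fin n) (Fin n) ℂ) (R : Submodule ℂ ((Fin n → ℂ) × (Fin n → ℂ)))
    (M : Matrix (Fin n) (Fin n) ℂ) : Submodule ℂ (Fin n → ℂ) :=
  (RK K R).comap (LinearMap.id.prod M.mulVecLin)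

end Boundary

end MaslovType

open MaslovType

/-!
Let `L t` be the graph of `γ t`, `W = W_K(R)`, and let `F` be the Lagrangian subspace of vectors
`(0, x₂, 0, x₄)` of `ℂ⁴ⁿ`. As `γ t` is block lower triangular, `L t ∩ F` has dimension `n` for
all `t`. So the position of `L t` relative to `W` can be compared with its position relative to
`F`, which does not change.

Fix a splitting, generators `U t` of `L t` and `V` of `W`, and an angle `θ` such that
`ζ = exp (-i θ)` is not an eigenvalue of `U t V⁻¹` for `t` in some interval. Then
`Z = {x + ζ V x}` is a Lagrangian complement of `W` transversal to `L t`, so that `L t` is the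
range of a section `ℓ` over `W` along `Z` and is described by the Hermitian form
`ω(w, ℓ w')` on `W`. In the coordinates of `H⁻` this form is a function of the unitary map
`U t V⁻¹`, which is positive exactly on the eigenvalues in the arc from `ζ` to `1`; hence its
positive index is the number of eigenvalues counted by the spectral flow
(`finrank_spectralSubspace_eq_posIndex`).

For a Hermitian form `h` on `V` and a subspace `D`,
`m⁺(h) = m⁺(h|D) + m⁺(h|D^⊥) + dim (D ∩ D^⊥) - dim (D ∩ ker h)` (`IsHerm.posIndex_eq_perp`).
Apply this on `W × F`, with the form of `L t` on `W` and minus the form of `F` on `F`, to the copy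
`D = {(π f, f)}` of `F`, where `π` is the projection to `W` along `Z` (`posIndex_sectionForm`).
The form on `D` measures the position of `L t` relative to `F`; its kernel has constant dimension,
so by continuity its index is constant. The form on `D^⊥` is the form `ω(w, f)` on
`L t ∩ (W + F)`, and its index is that of `M₁₁ᴴ Kᴴ M₂₁` on `S t`. The remaining variable term
`dim (L t ∩ W ∩ F)` differs from `dim S t` by a constant, because the graphs of `M₁₁ t` and
`M₂₂ t` are orthogonal to each other (`finrank_Gr_inf`). So on the interval the number of
eigenvalues in the arc minus `m⁺ - dim S` is constant, and summation over a partition gives the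
index. Partitions as in the definition exist by the Lebesgue number lemma.

The dimension formula follows by projecting `L t ∩ W` to the first coordinate: the image is the
kernel of the form on `S t`, the kernel is `L t ∩ W ∩ F`.
-/

/-! ### Hermitian forms and their positive index -/

section HermitianForms

open Module

variable {V V' : Type*} [AddCommGroup V] [Module ℂ V] [AddCommGroup V'] [Module ℂ V']

/-- A sesquilinear form `h` is Hermitian if `h x y` is the complex conjugate of `h y x`. -/
def IsHerm (h : V →ₗ[ℂ] V →ₗ⋆[ℂ] ℂ) : Prop :=
  ∀ x y, h x y = star (h y x)

/-- The positive index of `h` on a subspace `S`: the maximal dimension of a subspace of `S` on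
which `h` is positive definite. For `h = form A` it is `morsePos A S`. -/
noncomputable def posIndex (h : V →ₗ[ℂ] V →ₗ⋆[ℂ] ℂ) (S : Submodule ℂ V) : ℕ :=
  sSup {d | ∃ P : Submodule ℂ V, P ≤ S ∧ (∀ x ∈ P, x ≠ 0 → 0 < (h x x).re) ∧ finrank ℂ P = d}

/-- The left orthogonal `{x | h x d = 0 for all d ∈ D}` of a subspace `D`. -/
def perp (h : V →ₗ[ℂ] V →ₗ⋆[ℂ] ℂ) (D : Submodule ℂ V) : Submodule ℂ V where
  carrier := {x | ∀ d ∈ D, h x d = 0}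
  add_mem' := fun hx hy d hd => by simp [hx d hd, hy d hd]
  zero_mem' := fun d _ => by simp
  smul_mem' := fun c x hx d hd => by simp [hx d hd]

theorem mem_perp {h : V →ₗ[ℂ] V →ₗ⋆[ℂ] ℂ} {D : Submodule ℂ V} {x : V} :
    x ∈ perp h D ↔ ∀ d ∈ D, h x d = 0 := Iff.rfl

/-- The pullback `(x, y) ↦ h (f x) (f y)` of a sesquilinear form. -/
def pullback (h : V →ₗ[ℂ] V →ₗ⋆[ℂ] ℂ) (f : V' →ₗ[ℂ] V) : V' →ₗ[ℂ] V' →ₗ⋆[ℂ] ℂ :=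
  (h ∘ₗ f).compl₂ f

@[simp] theorem pullback_apply (h : V →ₗ[ℂ] V →ₗ⋆[ℂ] ℂ) (f : V' →ₗ[ℂ] V) (x y : V') :
    pullback h f x y = h (f x) (f y) := rfl

/-- The orthogonal direct sum of two sesquilinear forms. -/
def directSumForm (a : V →ₗ[ℂ] V →ₗ⋆[ℂ] ℂ) (b : V' →ₗ[ℂ] V' →ₗ⋆[ℂ] ℂ) :
    (V × V') →ₗ[ℂ] (V × V') →ₗ⋆[ℂ] ℂ :=
  pullback a (LinearMap.fst ℂ V V') + pullback b (LinearMap.snd ℂ V V')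

@[simp] theorem directSumForm_apply (a : V →ₗ[ℂ] V →ₗ⋆[ℂ] ℂ) (b : V' →ₗ[ℂ] V' →ₗ⋆[ℂ] ℂ)
    (x y : V × V') : directSumForm a b x y = a x.1 y.1 + b x.2 y.2 := rfl

theorem IsHerm.pullback {h : V →ₗ[ℂ] V →ₗ⋆[ℂ] ℂ} (hh : IsHerm h) (f : V' →ₗ[ℂ] V) :
    IsHerm (pullback h f) := fun _ _ => hh _ _

theorem IsHerm.neg {h : V →ₗ[ℂ] V →ₗ⋆[ℂ] ℂ} (hh : IsHerm h) : IsHerm (-h) := fun x y => by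
  simp [hh x y]

theorem IsHerm.directSumForm {a : V →ₗ[ℂ] V →ₗ⋆[ℂ] ℂ} {b : V' →ₗ[ℂ] V' →ₗ⋆[ℂ] ℂ}
    (ha : IsHerm a) (hb : IsHerm b) : IsHerm (directSumForm a b) := fun x y => by
  simp only [directSumForm_apply, star_add]
  rw [ha, hb]

theorem IsHerm.eq_zero_comm {h : V →ₗ[ℂ] V →ₗ⋆[ℂ] ℂ} (hh : IsHerm h) {x y : V}
    (H : h x y = 0) : h y x = 0 := by
  rw [hh, H, star_zero]

theorem IsHerm.eq_re {h : V →ₗ[ℂ] V →ₗ⋆[ℂ] ℂ} (hh : IsHerm h) (x : V) :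
    h x x = ((h x x).re : ℂ) :=
  (Complex.conj_eq_iff_re.mp (hh x x).symm).symm

/-- For a semidefinite form, every isotropic vector lies in the kernel. -/
theorem IsHerm.eq_zero_of_nonpos {h : V →ₗ[ℂ] V →ₗ⋆[ℂ] ℂ} (hh : IsHerm h) {N : Submodule ℂ V}
    (hN : ∀ x ∈ N, (h x x).re ≤ 0) {x y : V} (hx : x ∈ N) (hy : y ∈ N) (h0 : (h x x).re = 0) :
    h x y = 0 := by
  by_contra hne
  have hpos : 0 < Complex.normSq (h x y) := Complex.normSq_pos.mpr hne
  have key : ∀ t : ℝ, 2 * t * Complex.normSq (h x y) + (h y y).re ≤ 0 := by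
    intro t
    have h1 := hN _ (N.add_mem (N.smul_mem ((t : ℂ) * star (h x y)) hx) hy)
    have h2 : h x x = 0 := by rw [hh.eq_re, h0, Complex.ofReal_zero]
    have h3 : h ((t * star (h x y)) • x + y) ((t * star (h x y)) • x + y)
        = ((2 * t * Complex.normSq (h x y) : ℝ) : ℂ) + h y y := by
      simp only [map_add, LinearMap.add_apply, map_smul, LinearMap.smul_apply, map_smulₛₗ, h2,
        smul_eq_mul, hh y x]
      push_cast
      rw [Complex.normSq_eq_conj_mul_self]
      simp
      ring
    rw [h3] at h1
    simpa using h1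
  have := key ((1 - (h y y).re) / (2 * Complex.normSq (h x y)))
  field_simp at this
  linarith

theorem disjoint_of_pos_of_nonpos {h : V →ₗ[ℂ] V →ₗ⋆[ℂ] ℂ} {P N : Submodule ℂ V}
    (hP : ∀ x ∈ P, x ≠ 0 → 0 < (h x x).re) (hN : ∀ x ∈ N, (h x x).re ≤ 0) : Disjoint P N := by
  rw [Submodule.disjoint_def]
  intro x hx hx'
  by_contra h0
  exact (hP x hx h0).not_ge (hN x hx')

theorem finrank_map_of_disjoint_ker (f : V →ₗ[ℂ] V') {P : Submodule ℂ V}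
    (hP : Disjoint P (LinearMap.ker f)) : finrank ℂ (P.map f) = finrank ℂ P := by
  rw [← LinearMap.range_domRestrict]
  apply LinearMap.finrank_range_of_inj
  rw [← LinearMap.ker_eq_bot, LinearMap.ker_domRestrict]
  exact Submodule.disjoint_iff_comap_eq_bot.mp hP

variable [FiniteDimensional ℂ V]

theorem bddAbove_posDef (h : V →ₗ[ℂ] V →ₗ⋆[ℂ] ℂ) (S : Submodule ℂ V) :
    BddAbove {d | ∃ P : Submodule ℂ V, P ≤ S ∧ (∀ x ∈ P, x ≠ 0 → 0 < (h x x).re) ∧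
      finrank ℂ P = d} :=
  ⟨finrank ℂ V, by rintro d ⟨P, -, -, rfl⟩; exact P.finrank_le⟩

theorem finrank_le_posIndex {h : V →ₗ[ℂ] V →ₗ⋆[ℂ] ℂ} {S P : Submodule ℂ V} (hPS : P ≤ S)
    (hP : ∀ x ∈ P, x ≠ 0 → 0 < (h x x).re) : finrank ℂ P ≤ posIndex h S :=
  le_csSup (bddAbove_posDef h S) ⟨P, hPS, hP, rfl⟩

theorem exists_finrank_eq_posIndex (h : V →ₗ[ℂ] V →ₗ⋆[ℂ] ℂ) (S : Submodule ℂ V) :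
    ∃ P : Submodule ℂ V, P ≤ S ∧ (∀ x ∈ P, x ≠ 0 → 0 < (h x x).re) ∧
      finrank ℂ P = posIndex h S :=
  Nat.sSup_mem
    (s := {d | ∃ P : Submodule ℂ V, P ≤ S ∧ (∀ x ∈ P, x ≠ 0 → 0 < (h x x).re) ∧
      finrank ℂ P = d})
    ⟨0, ⊥, bot_le, fun _ hx h0 => absurd ((Submodule.mem_bot ℂ).mp hx) h0, finrank_bot ℂ V⟩
    (bddAbove_posDef h S)

theorem posIndex_add_finrank_le {h : V →ₗ[ℂ] V →ₗ⋆[ℂ] ℂ} {S N : Submodule ℂ V} (hNS : N ≤ S)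
    (hN : ∀ x ∈ N, (h x x).re ≤ 0) : posIndex h S + finrank ℂ N ≤ finrank ℂ S := by
  obtain ⟨P, hPS, hP, hd⟩ := exists_finrank_eq_posIndex h S
  rw [← hd, ← Submodule.finrank_sup_add_finrank_inf_eq,
    (disjoint_of_pos_of_nonpos hP hN).eq_bot, finrank_bot, add_zero]
  exact Submodule.finrank_mono (sup_le hPS hNS)

/-- A decomposition into a positive definite and a negative semidefinite subspace computes the
positive index. -/
theorem posIndex_eq_of_decomp {h : V →ₗ[ℂ] V →ₗ⋆[ℂ] ℂ} {S P N : Submodule ℂ V}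
    (hPS : P ≤ S) (hNS : N ≤ S) (hPN : S ≤ P ⊔ N) (hP : ∀ x ∈ P, x ≠ 0 → 0 < (h x x).re)
    (hN : ∀ x ∈ N, (h x x).re ≤ 0) : posIndex h S = finrank ℂ P := by
  have h1 := posIndex_add_finrank_le hNS hN
  have h2 := Submodule.finrank_add_le_finrank_add_finrank P N
  have h3 := Submodule.finrank_mono hPN
  have h4 := finrank_le_posIndex hPS hP
  omega

/-- The orthogonal of a subspace that meets the right kernel of `h` trivially has the expected
dimension. -/
theorem finrank_perp_of_disjoint {h : V →ₗ[ℂ] V →ₗ⋆[ℂ] ℂ} {C : Submodule ℂ V}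
    (hC : ∀ c ∈ C, (∀ x, h x c = 0) → c = 0) :
    finrank ℂ (perp h C) + finrank ℂ C = finrank ℂ V := by
  let b := finBasis ℂ C
  let Ψ : V →ₗ[ℂ] (Fin (finrank ℂ C) → ℂ) := LinearMap.pi fun i => h.flip (b i)
  have hker : LinearMap.ker Ψ = perp h C := by
    ext x
    rw [LinearMap.mem_ker, mem_perp]
    constructor
    · intro hx d hd
      have := b.sum_repr ⟨d, hd⟩
      have h2 : d = ∑ i, b.repr ⟨d, hd⟩ i • (b i : V) := by
        have h0 := congrArg C.subtype this
        rw [map_sum] at h0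
        exact h0.symm
      rw [h2, map_sum]
      refine Finset.sum_eq_zero fun i _ => ?_
      have h3 : h x (b i) = 0 := congrFun hx i
      rw [map_smulₛₗ, h3, smul_zero]
    · intro hx
      ext i
      exact hx _ (b i).2
  have hrange : LinearMap.range Ψ = ⊤ := by
    by_contra hne
    obtain ⟨f, hf, hle⟩ := Submodule.exists_le_ker_of_lt_top _ (lt_top_iff_ne_top.mpr hne)
    have hfsum : ∀ v : Fin (finrank ℂ C) → ℂ, f v = ∑ i, v i * f (Pi.single i 1) := by
      intro v
      conv_lhs => rw [← Finset.univ_sum_single v]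
      rw [map_sum]
      refine Finset.sum_congr rfl fun i _ => ?_
      rw [← smul_eq_mul, ← map_smul]
      congr 1
      ext j
      simp [Pi.single_apply]
    have hc := hC (∑ i, star (f (Pi.single i 1)) • (b i : V))
      (C.sum_mem fun i _ => C.smul_mem _ (b i).2) (by
        intro x
        have h1 : f (Ψ x) = 0 := hle (LinearMap.mem_range_self _ x)
        rw [hfsum] at h1
        rw [map_sum, ← h1]
        refine Finset.sum_congr rfl fun i _ => ?_
        rw [map_smulₛₗ]
        simp [Ψ, mul_comm])
    have hlin := Fintype.linearIndependent_iff.mp b.linearIndependent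
      (fun i => star (f (Pi.single i 1))) (by
        apply Subtype.ext
        simpa using hc)
    apply hf
    ext i
    simpa using hlin i
  have := LinearMap.finrank_range_add_finrank_ker Ψ
  rw [hrange, hker, finrank_top, finrank_fin_fun] at this
  omega

theorem exists_compl_inf (D E : Submodule ℂ V) :
    ∃ C ≤ D, Disjoint C E ∧ C ⊔ (D ⊓ E) = D ∧ finrank ℂ C + finrank ℂ ↥(D ⊓ E) = finrank ℂ D := by
  obtain ⟨C, hC⟩ := exists_isCompl (Submodule.comap D.subtype (D ⊓ E))
  have hCD : C.map D.subtype ≤ D := Submodule.map_subtype_le D C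
  have hdis : Disjoint (C.map D.subtype) E := by
    rw [Submodule.disjoint_def]
    rintro _ ⟨x, hx, rfl⟩ hxE
    have := Submodule.disjoint_def.mp hC.disjoint x ⟨x.2, hxE⟩ hx
    simp [this]
  have hsup : C.map D.subtype ⊔ (D ⊓ E) = D := by
    have := congrArg (Submodule.map D.subtype) hC.sup_eq_top
    rw [Submodule.map_sup, Submodule.map_comap_subtype, Submodule.map_top,
      Submodule.range_subtype, ← inf_assoc, inf_idem] at this
    rw [sup_comm, this]
  refine ⟨_, hCD, hdis, hsup, ?_⟩
  rw [← Submodule.finrank_sup_add_finrank_inf_eq, hsup,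
    (hdis.mono_right inf_le_right).eq_bot, finrank_bot, add_zero]

theorem IsHerm.finrank_perp {h : V →ₗ[ℂ] V →ₗ⋆[ℂ] ℂ} (hh : IsHerm h) (D : Submodule ℂ V) :
    finrank ℂ (perp h D) + finrank ℂ D
      = finrank ℂ V + finrank ℂ ↥(D ⊓ LinearMap.ker h) := by
  obtain ⟨C, hCD, hdis, hsup, hd⟩ := exists_compl_inf D (LinearMap.ker h)
  have h1 : perp h D = perp h C := by
    apply le_antisymm (fun x hx d hd => hx d (hCD hd))
    intro x hx d hd
    rw [← hsup] at hd
    obtain ⟨c, hc, e, he, rfl⟩ := Submodule.mem_sup.mp hd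
    have h2 : h e = 0 := he.2
    have h3 : h x e = 0 := hh.eq_zero_comm (by rw [h2, LinearMap.zero_apply])
    rw [map_add, hx c hc, h3, add_zero]
  have h2 := finrank_perp_of_disjoint (h := h) (C := C) (by
    intro c hc hx
    refine Submodule.disjoint_def.mp hdis c hc ?_
    rw [LinearMap.mem_ker]
    ext x
    exact hh.eq_zero_comm (hx x))
  rw [h1]
  omega

/-- A subspace of maximal dimension on which `h` is positive definite has an orthogonal complement
on which `h` is negative semidefinite. -/
theorem IsHerm.exists_decomp {h : V →ₗ[ℂ] V →ₗ⋆[ℂ] ℂ} (hh : IsHerm h) :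
    ∃ P N : Submodule ℂ V, IsCompl P N ∧ (∀ x ∈ P, x ≠ 0 → 0 < (h x x).re) ∧
      (∀ x ∈ N, (h x x).re ≤ 0) ∧ (∀ x ∈ N, ∀ y ∈ P, h x y = 0) ∧
      finrank ℂ P = posIndex h ⊤ := by
  obtain ⟨P, -, hP, hd⟩ := exists_finrank_eq_posIndex h ⊤
  have hdis : Disjoint P (perp h P) := by
    rw [Submodule.disjoint_def]
    intro x hx hx'
    by_contra h0
    have := hP x hx h0
    rw [hx' x hx] at this
    simp at this
  refine ⟨P, perp h P, ⟨hdis, ?_⟩, hP, ?_, fun x hx => hx, hd⟩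
  · rw [codisjoint_iff]
    apply Submodule.eq_top_of_finrank_eq
    have h1 := Submodule.finrank_sup_add_finrank_inf_eq P (perp h P)
    rw [hdis.eq_bot, finrank_bot] at h1
    have h2 := hh.finrank_perp P
    have h3 := Submodule.finrank_le (P ⊔ perp h P)
    omega
  · intro x hx
    by_contra! hpos
    have hx0 : x ≠ 0 := by rintro rfl; simp at hpos
    have hdis' : Disjoint P (ℂ ∙ x) :=
      hdis.mono_right ((Submodule.span_singleton_le_iff_mem x _).mpr hx)
    have h1 := Submodule.finrank_sup_add_finrank_inf_eq P (ℂ ∙ x)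
    rw [hdis'.eq_bot, finrank_bot, finrank_span_singleton hx0] at h1
    have h2 := finrank_le_posIndex (h := h) (le_top (a := P ⊔ ℂ ∙ x)) (by
      intro y hy hy0
      obtain ⟨p, hp, q, hq, rfl⟩ := Submodule.mem_sup.mp hy
      obtain ⟨c, rfl⟩ := Submodule.mem_span_singleton.mp hq
      have h3 : h x p = 0 := hx p hp
      have h4 : h (p + c • x) (p + c • x) = h p p + (Complex.normSq c : ℂ) * h x x := by
        simp only [map_add, LinearMap.add_apply, map_smul, LinearMap.smul_apply, map_smulₛₗ, h3,
          hh.eq_zero_comm h3, smul_eq_mul, Complex.normSq_eq_conj_mul_self]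
        ring
      rw [h4, Complex.add_re, Complex.re_ofReal_mul]
      by_cases hp0 : p = 0
      · have hc : c ≠ 0 := by rintro rfl; simp [hp0] at hy0
        simpa [hp0] using mul_pos (Complex.normSq_pos.mpr hc) hpos
      · exact add_pos_of_pos_of_nonneg (hP p hp hp0)
          (mul_nonneg (Complex.normSq_nonneg c) hpos.le))
    omega

/-- A subspace on which `h` is positive semidefinite has, modulo the kernel of `h`, dimension at
most the positive index. -/
theorem IsHerm.finrank_le_of_nonneg {h : V →ₗ[ℂ] V →ₗ⋆[ℂ] ℂ} (hh : IsHerm h) {E : Submodule ℂ V}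
    (hE : ∀ x ∈ E, 0 ≤ (h x x).re) :
    finrank ℂ E ≤ posIndex h ⊤ + finrank ℂ ↥(E ⊓ LinearMap.ker h) := by
  obtain ⟨P, N, hc, hP, hN, hPN, hd⟩ := hh.exists_decomp
  have hle : E ⊓ N ≤ E ⊓ LinearMap.ker h := by
    rintro x ⟨hxE, hxN⟩
    refine ⟨hxE, LinearMap.mem_ker.mpr ?_⟩
    ext y
    obtain ⟨p, hp, q, hq, rfl⟩ := Submodule.mem_sup.mp
      (show y ∈ P ⊔ N from hc.sup_eq_top ▸ Submodule.mem_top)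
    rw [map_add, hPN x hxN p hp,
      hh.eq_zero_of_nonpos hN hxN hq (le_antisymm (hN x hxN) (hE x hxE))]
    simp
  have h1 := Submodule.finrank_sup_add_finrank_inf_eq E N
  have h2 := Submodule.finrank_mono hle
  have h3 := Submodule.finrank_le (E ⊔ N)
  have h4 := Submodule.finrank_add_eq_of_isCompl hc
  omega

theorem IsHerm.posIndex_add_posIndex_neg {h : V →ₗ[ℂ] V →ₗ⋆[ℂ] ℂ} (hh : IsHerm h) :
    posIndex h ⊤ + posIndex (-h) ⊤ + finrank ℂ (LinearMap.ker h) = finrank ℂ V := by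
  apply le_antisymm
  · obtain ⟨Q, -, hQ, hd⟩ := exists_finrank_eq_posIndex (-h) ⊤
    have hk : ∀ x ∈ LinearMap.ker h, ∀ y, h x y = 0 ∧ h y x = 0 := by
      intro x hx y
      have : h x y = 0 := by rw [LinearMap.mem_ker.mp hx, LinearMap.zero_apply]
      exact ⟨this, hh.eq_zero_comm this⟩
    have hdis : Disjoint Q (LinearMap.ker h) := by
      apply disjoint_of_pos_of_nonpos hQ
      intro x hx
      simp [(hk x hx x).1]
    have h1 := Submodule.finrank_sup_add_finrank_inf_eq Q (LinearMap.ker h)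
    rw [hdis.eq_bot, finrank_bot] at h1
    have h2 := posIndex_add_finrank_le (h := h) (le_top (a := Q ⊔ LinearMap.ker h)) (by
      intro x hx
      obtain ⟨q, hq, k, hk', rfl⟩ := Submodule.mem_sup.mp hx
      have h3 : h (q + k) (q + k) = h q q := by
        simp [(hk k hk' q).1, (hk k hk' q).2, (hk k hk' k).1]
      rw [h3]
      by_cases hq0 : q = 0
      · simp [hq0]
      · have := hQ q hq hq0
        simp at this
        exact this.le)
    rw [finrank_top] at h2
    omega
  · obtain ⟨P, N, hc, hP, hN, hPN, hd⟩ := hh.exists_decomp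
    have h1 := hh.neg.finrank_le_of_nonneg (E := N) (by
      intro x hx
      simpa using hN x hx)
    have h2 : finrank ℂ ↥(N ⊓ LinearMap.ker (-h)) ≤ finrank ℂ (LinearMap.ker h) := by
      apply Submodule.finrank_mono
      intro x hx
      simpa using hx.2
    have h4 := Submodule.finrank_add_eq_of_isCompl hc
    omega

variable [FiniteDimensional ℂ V']

/-- The positive index only depends on the values on the diagonal, and can be computed on the image
under any linear map that respects these values. -/
theorem posIndex_map {h : V →ₗ[ℂ] V →ₗ⋆[ℂ] ℂ} {h' : V' →ₗ[ℂ] V' →ₗ⋆[ℂ] ℂ} (f : V →ₗ[ℂ] V')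
    {S : Submodule ℂ V} (H : ∀ x ∈ S, (h x x).re = (h' (f x) (f x)).re) :
    posIndex h S = posIndex h' (S.map f) := by
  apply le_antisymm
  · obtain ⟨P, hPS, hP, hd⟩ := exists_finrank_eq_posIndex h S
    have hinj : Disjoint P (LinearMap.ker f) := by
      rw [Submodule.disjoint_def]
      intro x hx hx'
      by_contra h0
      have := hP x hx h0
      rw [H x (hPS hx), LinearMap.mem_ker.mp hx'] at this
      simp at this
    rw [← hd]
    have : finrank ℂ (P.map f) = finrank ℂ P :=
      finrank_map_of_disjoint_ker f hinj
    rw [← this]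
    apply finrank_le_posIndex (Submodule.map_mono hPS)
    rintro _ ⟨x, hx, rfl⟩ h0
    rw [← H x (hPS hx)]
    exact hP x hx (by rintro rfl; simp at h0)
  · obtain ⟨P, hPS, hP, hd⟩ := exists_finrank_eq_posIndex h' (S.map f)
    obtain ⟨C, hCD, hdis, hsup, -⟩ := exists_compl_inf (S ⊓ P.comap f) (LinearMap.ker f)
    have hmap : C.map f = P := by
      have h1 : (S ⊓ P.comap f).map f = P := by
        apply le_antisymm
        · rintro _ ⟨x, hx, rfl⟩
          exact hx.2
        · intro y hy
          obtain ⟨x, hx, rfl⟩ := hPS hy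
          exact ⟨x, ⟨hx, hy⟩, rfl⟩
      rw [← h1, ← hsup, Submodule.map_sup]
      symm
      rw [sup_eq_left]
      rintro _ ⟨x, hx, rfl⟩
      rw [LinearMap.mem_ker.mp hx.2]
      exact Submodule.zero_mem _
    have : finrank ℂ (C.map f) = finrank ℂ C :=
      finrank_map_of_disjoint_ker f hdis
    rw [← hd, ← hmap, this]
    apply finrank_le_posIndex (fun x hx => (hCD hx).1)
    intro x hx h0
    rw [H x (hCD hx).1]
    apply hP _ (hCD hx).2
    intro h1
    exact h0 (Submodule.disjoint_def.mp hdis x hx h1)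

theorem IsHerm.posIndex_add_posIndex_neg_on {h : V →ₗ[ℂ] V →ₗ⋆[ℂ] ℂ} (hh : IsHerm h)
    (S : Submodule ℂ V) :
    posIndex h S + posIndex (-h) S + finrank ℂ ↥(S ⊓ perp h S) = finrank ℂ S := by
  have h1 := (hh.pullback S.subtype).posIndex_add_posIndex_neg
  rw [posIndex_map (h' := h) S.subtype (fun x _ => rfl),
    posIndex_map (h := -_root_.pullback h S.subtype) (h' := -h) S.subtype (fun x _ => rfl),
    Submodule.map_top, Submodule.range_subtype] at h1
  have h2 : (LinearMap.ker (_root_.pullback h S.subtype)).map S.subtype = S ⊓ perp h S := by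
    ext x
    constructor
    · rintro ⟨y, hy, rfl⟩
      refine ⟨y.2, fun d hd => ?_⟩
      exact LinearMap.congr_fun (LinearMap.mem_ker.mp hy) ⟨d, hd⟩
    · rintro ⟨hx, hx'⟩
      refine ⟨⟨x, hx⟩, ?_, rfl⟩
      rw [SetLike.mem_coe, LinearMap.mem_ker]
      ext d
      exact hx' d d.2
  rw [← h2, finrank_map_of_disjoint_ker _ (by rw [Submodule.ker_subtype]; exact disjoint_bot_right)]
  exact h1

/-- The inequality follows by applying `IsHerm.finrank_le_of_nonneg` to the sum of maximal positive
definite subspaces of `D` and of its orthogonal and of the intersection of the two. -/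
theorem IsHerm.posIndex_perp_le {h : V →ₗ[ℂ] V →ₗ⋆[ℂ] ℂ} (hh : IsHerm h) (D : Submodule ℂ V) :
    posIndex h D + posIndex h (perp h D) + finrank ℂ ↥(D ⊓ perp h D)
      ≤ posIndex h ⊤ + finrank ℂ ↥(D ⊓ LinearMap.ker h) := by
  obtain ⟨P, hPD, hP, hdP⟩ := exists_finrank_eq_posIndex h D
  obtain ⟨Q, hQD, hQ, hdQ⟩ := exists_finrank_eq_posIndex h (perp h D)
  -- `h` is positive semidefinite on the sum of the mutually orthogonal spaces `P`, `Q`, `D ∩ D^⊥`.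
  have hPQ : ∀ p ∈ P, ∀ q ∈ Q, h q p = 0 ∧ h p q = 0 := fun p hp q hq =>
    ⟨hQD hq p (hPD hp), hh.eq_zero_comm (hQD hq p (hPD hp))⟩
  have hPd : ∀ p ∈ P, ∀ d ∈ D ⊓ perp h D, h d p = 0 ∧ h p d = 0 := fun p hp d hd =>
    ⟨hd.2 p (hPD hp), hh.eq_zero_comm (hd.2 p (hPD hp))⟩
  have hQd : ∀ q ∈ Q, ∀ d ∈ D ⊓ perp h D, h q d = 0 ∧ h d q = 0 := fun q hq d hd =>
    ⟨hQD hq d hd.1, hh.eq_zero_comm (hQD hq d hd.1)⟩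
  have hdd : ∀ d ∈ D ⊓ perp h D, h d d = 0 := fun d hd => hd.2 d hd.1
  have hP0 : ∀ p ∈ P, h p p = 0 → p = 0 := by
    intro p hp h0
    by_contra hne
    have := hP p hp hne
    simp [h0] at this
  have hQ0 : ∀ q ∈ Q, h q q = 0 → q = 0 := by
    intro p hp h0
    by_contra hne
    have := hQ p hp hne
    simp [h0] at this
  have hdis1 : Disjoint P Q := by
    rw [Submodule.disjoint_def]
    exact fun x hx hx' => hP0 x hx (hPQ x hx x hx').1
  have hdis2 : Disjoint (P ⊔ Q) (D ⊓ perp h D) := by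
    rw [Submodule.disjoint_def]
    intro x hx hx'
    obtain ⟨p, hp, q, hq, rfl⟩ := Submodule.mem_sup.mp hx
    have h1 := (hPd p hp _ hx').1
    have h2 := (hQd q hq _ hx').2
    rw [map_add, LinearMap.add_apply] at h1 h2
    rw [(hPQ p hp q hq).1, add_zero] at h1
    rw [(hPQ p hp q hq).2, zero_add] at h2
    rw [hP0 p hp h1, hQ0 q hq h2, add_zero]
  have h1 := Submodule.finrank_sup_add_finrank_inf_eq P Q
  have h2 := Submodule.finrank_sup_add_finrank_inf_eq (P ⊔ Q) (D ⊓ perp h D)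
  rw [hdis1.eq_bot, finrank_bot] at h1
  rw [hdis2.eq_bot, finrank_bot] at h2
  have h3 := hh.finrank_le_of_nonneg (E := P ⊔ Q ⊔ D ⊓ perp h D) (by
    intro x hx
    obtain ⟨y, hy, d, hd, rfl⟩ := Submodule.mem_sup.mp hx
    obtain ⟨p, hp, q, hq, rfl⟩ := Submodule.mem_sup.mp hy
    have : h (p + q + d) (p + q + d) = h p p + h q q := by
      simp only [map_add, LinearMap.add_apply, (hPQ p hp q hq).1, (hPQ p hp q hq).2,
        (hPd p hp d hd).1, (hPd p hp d hd).2, (hQd q hq d hd).1, (hQd q hq d hd).2, hdd d hd]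
      ring
    rw [this, Complex.add_re]
    have h4 : 0 ≤ (h p p).re := by
      by_cases h0 : p = 0
      · simp [h0]
      · exact (hP p hp h0).le
    have h5 : 0 ≤ (h q q).re := by
      by_cases h0 : q = 0
      · simp [h0]
      · exact (hQ q hq h0).le
    exact add_nonneg h4 h5)
  have h4 : finrank ℂ ↥((P ⊔ Q ⊔ D ⊓ perp h D) ⊓ LinearMap.ker h)
      ≤ finrank ℂ ↥(D ⊓ LinearMap.ker h) := by
    apply Submodule.finrank_mono
    rintro x ⟨hx, hx'⟩
    refine ⟨?_, hx'⟩
    obtain ⟨y, hy, d, hd, rfl⟩ := Submodule.mem_sup.mp hx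
    obtain ⟨p, hp, q, hq, rfl⟩ := Submodule.mem_sup.mp hy
    have hk : ∀ z, h (p + q + d) z = 0 := fun z => by
      rw [LinearMap.mem_ker.mp hx', LinearMap.zero_apply]
    have h5 := hk p
    have h6 := hk q
    simp only [map_add, LinearMap.add_apply, (hPQ p hp q hq).1, (hPd p hp d hd).1, add_zero] at h5
    simp only [map_add, LinearMap.add_apply, (hPQ p hp q hq).2, (hQd q hq d hd).2, add_zero,
      zero_add] at h6
    rw [hP0 p hp h5, hQ0 q hq h6, zero_add, zero_add]
    exact hd.1
  omega

/-- The behaviour of the positive index under passage to a subspace and its orthogonal: the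
inequality `IsHerm.posIndex_perp_le` for `h` and for `-h` adds up to an equality. -/
theorem IsHerm.posIndex_eq_perp {h : V →ₗ[ℂ] V →ₗ⋆[ℂ] ℂ} (hh : IsHerm h) (D : Submodule ℂ V) :
    posIndex h D + posIndex h (perp h D) + finrank ℂ ↥(D ⊓ perp h D)
      = posIndex h ⊤ + finrank ℂ ↥(D ⊓ LinearMap.ker h) := by
  have hperp : ∀ E, perp (-h) E = perp h E := by
    intro E
    ext x
    simp [mem_perp]
  have hker : LinearMap.ker (-h) = LinearMap.ker h := by
    ext x
    simp
  have h1 := hh.posIndex_perp_le D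
  have h2 := hh.neg.posIndex_perp_le D
  rw [hperp, hker] at h2
  have h3 := hh.posIndex_add_posIndex_neg
  have h4 := hh.posIndex_add_posIndex_neg_on D
  have h5 := hh.posIndex_add_posIndex_neg_on (perp h D)
  have h6 := hh.finrank_perp D
  have h7 : perp h D ⊓ perp h (perp h D) = perp h (D ⊔ perp h D) := by
    ext x
    constructor
    · rintro ⟨hx, hx'⟩ y hy
      obtain ⟨p, hp, q, hq, rfl⟩ := Submodule.mem_sup.mp hy
      rw [map_add, hx p hp, hx' q hq, add_zero]
    · intro hx
      exact ⟨fun d hd => hx d (Submodule.mem_sup_left hd),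
        fun d hd => hx d (Submodule.mem_sup_right hd)⟩
  have h8 := hh.finrank_perp (D ⊔ perp h D)
  have h9 : (D ⊔ perp h D) ⊓ LinearMap.ker h = LinearMap.ker h := by
    rw [inf_eq_right]
    intro x hx
    apply Submodule.mem_sup_right
    intro d _
    rw [LinearMap.mem_ker.mp hx, LinearMap.zero_apply]
  rw [h9, ← h7] at h8
  have h10 := Submodule.finrank_sup_add_finrank_inf_eq D (perp h D)
  omega

theorem posIndex_directSumForm {a : V →ₗ[ℂ] V →ₗ⋆[ℂ] ℂ} {b : V' →ₗ[ℂ] V' →ₗ⋆[ℂ] ℂ}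
    (ha : IsHerm a) (hb : IsHerm b) :
    posIndex (directSumForm a b) ⊤ = posIndex a ⊤ + posIndex b ⊤ := by
  obtain ⟨P, N, hc, hP, hN, -, hd⟩ := ha.exists_decomp
  obtain ⟨P', N', hc', hP', hN', -, hd'⟩ := hb.exists_decomp
  rw [posIndex_eq_of_decomp (P := P.prod P') (N := N.prod N') le_top le_top, ← hd, ← hd']
  · have h1 : LinearMap.range (P.subtype.prodMap P'.subtype) = P.prod P' := by
      rw [LinearMap.range_prodMap, Submodule.range_subtype, Submodule.range_subtype]
    rw [← h1, LinearMap.finrank_range_of_inj, finrank_prod]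
    exact Prod.map_injective.mpr ⟨P.subtype_injective, P'.subtype_injective⟩
  · rw [Submodule.prod_sup_prod, hc.sup_eq_top, hc'.sup_eq_top, Submodule.prod_top]
  · rintro ⟨x, y⟩ ⟨hx, hy⟩ h0
    rw [directSumForm_apply, Complex.add_re]
    by_cases hx0 : x = 0
    · have hy0 : y ≠ 0 := by rintro rfl; simp [hx0] at h0
      simpa [hx0] using hP' y hy hy0
    · have h1 : 0 ≤ (b y y).re := by
        by_cases h0 : y = 0
        · simp [h0]
        · exact (hP' y hy h0).le
      exact add_pos_of_pos_of_nonneg (hP x hx hx0) h1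
  · rintro ⟨x, y⟩ ⟨hx, hy⟩
    rw [directSumForm_apply, Complex.add_re]
    exact add_nonpos (hN x hx) (hN' y hy)

end HermitianForms

/-! ### Continuous families of Hermitian forms -/

section Families

open Module Filter Topology

variable {V V' : Type*} [AddCommGroup V] [Module ℂ V] [AddCommGroup V'] [Module ℂ V']
variable {X : Type*} [TopologicalSpace X]

variable [FiniteDimensional ℂ V]

/-- The positive index is lower semicontinuous: a form positive definite on `P` stays so under
small perturbations, by compactness of the unit sphere of `P`. -/
theorem eventually_posIndex_le {c : X → V →ₗ[ℂ] V →ₗ⋆[ℂ] ℂ}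
    (hc : ∀ x y, Continuous fun s => c s x y) (s : X) :
    ∀ᶠ t in 𝓝 s, posIndex (c s) ⊤ ≤ posIndex (c t) ⊤ := by
  obtain ⟨P, -, hP, hd⟩ := exists_finrank_eq_posIndex (c s) ⊤
  let b := finBasis ℂ P
  let e : (Fin (finrank ℂ P) → ℂ) →ₗ[ℂ] V := P.subtype ∘ₗ b.equivFun.symm.toLinearMap
  have he : ∀ v, e v = ∑ i, v i • (b i : V) := fun v => by
    simp [e, Basis.equivFun_symm_apply]
  have hcont : Continuous fun z : X × (Fin (finrank ℂ P) → ℂ) => (c z.1 (e z.2) (e z.2)).re := by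
    have h1 : ∀ z : X × (Fin (finrank ℂ P) → ℂ), c z.1 (e z.2) (e z.2)
        = ∑ i, ∑ j, z.2 i * (star (z.2 j) * c z.1 (b i) (b j)) := by
      intro z
      simp only [he, map_sum, LinearMap.sum_apply, map_smul, LinearMap.smul_apply, map_smulₛₗ,
        smul_eq_mul, Finset.mul_sum]
      rw [Finset.sum_comm]
      refine Finset.sum_congr rfl fun i _ => Finset.sum_congr rfl fun j _ => ?_
      simp
      ring
    simp_rw [h1]
    refine Complex.continuous_re.comp (continuous_finsetSum _ fun i _ =>
      continuous_finsetSum _ fun j _ => ?_)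
    exact ((continuous_apply i).comp continuous_snd).mul
      ((continuous_star.comp ((continuous_apply j).comp continuous_snd)).mul
        ((hc _ _).comp continuous_fst))
  have hinj : Function.Injective e := P.subtype_injective.comp b.equivFun.symm.injective
  have hev : ∀ᶠ t in 𝓝 s, ∀ v ∈ Metric.sphere (0 : Fin (finrank ℂ P) → ℂ) 1,
      0 < (c t (e v) (e v)).re := by
    apply (isCompact_sphere _ _).eventually_forall_of_forall_eventually
    intro v hv
    refine hcont.continuousAt.eventually (lt_mem_nhds (hP _ (b.equivFun.symm v).2 ?_))
    intro h0
    have : v = 0 := hinj (by rw [map_zero]; exact h0)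
    rw [this] at hv
    simp at hv
  filter_upwards [hev] with t ht
  rw [← hd]
  apply finrank_le_posIndex le_top
  intro x hx hx0
  obtain ⟨v, hv⟩ : ∃ v, e v = x := ⟨b.equivFun ⟨x, hx⟩, by simp [e]⟩
  have hv0 : v ≠ 0 := by rintro rfl; exact hx0 (by rw [← hv, map_zero])
  have h1 := ht (((‖v‖ : ℂ)⁻¹) • v) (by
    rw [mem_sphere_zero_iff_norm, norm_smul, norm_inv, Complex.norm_real, norm_norm]
    exact inv_mul_cancel₀ (norm_ne_zero_iff.mpr hv0))
  have h2 : c t (e (((‖v‖ : ℂ)⁻¹) • v)) (e (((‖v‖ : ℂ)⁻¹) • v))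
      = ((‖v‖⁻¹ * ‖v‖⁻¹ : ℝ) : ℂ) * c t (e v) (e v) := by
    simp only [map_smul, LinearMap.smul_apply, map_smulₛₗ, smul_eq_mul]
    simp
    ring
  rw [h2, Complex.re_ofReal_mul, hv] at h1
  exact pos_of_mul_pos_right h1 (mul_self_nonneg _)

/-- In a continuous family of Hermitian forms with kernels of constant dimension the positive index
is constant: both it and the negative index are lower semicontinuous, and their sum is constant. -/
theorem posIndex_eq_of_finrank_ker_eq [PreconnectedSpace X] {c : X → V →ₗ[ℂ] V →ₗ⋆[ℂ] ℂ}
    (hh : ∀ s, IsHerm (c s)) (hc : ∀ x y, Continuous fun s => c s x y)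
    (hk : ∀ s t, finrank ℂ (LinearMap.ker (c s)) = finrank ℂ (LinearMap.ker (c t))) (s t : X) :
    posIndex (c s) ⊤ = posIndex (c t) ⊤ := by
  apply IsLocallyConstant.apply_eq_of_preconnectedSpace
    (f := fun s => posIndex (c s) ⊤)
  rw [IsLocallyConstant.iff_eventually_eq]
  intro s
  filter_upwards [eventually_posIndex_le hc s,
    eventually_posIndex_le (c := fun s => -c s) (fun x y => (hc x y).neg) s] with t h1 h2
  have h3 := (hh s).posIndex_add_posIndex_neg
  have h4 := (hh t).posIndex_add_posIndex_neg
  have h5 := hk s t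
  omega

section MatrixFamilies

variable {ι : Type*} [Fintype ι] [DecidableEq ι] {P : X → (ι → ℂ) →ₗ[ℂ] V}

/-- A family of linear maps from `ℂ^ι` to a space of the same dimension, continuous when tested on
vectors and functionals, has a continuous matrix. -/
theorem exists_continuous_matrix (hdim : finrank ℂ V = Fintype.card ι)
    (hP : ∀ (x : ι → ℂ) (f : V →ₗ[ℂ] ℂ), Continuous fun s => f (P s x)) :
    ∃ (e : V ≃ₗ[ℂ] (ι → ℂ)) (M : X → Matrix ι ι ℂ), Continuous M ∧
      (∀ s v, (M s).mulVec v = e (P s v)) ∧ ∀ s, IsUnit (M s).det ↔ Function.Injective (P s) := by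
  let e : V ≃ₗ[ℂ] (ι → ℂ) := LinearEquiv.ofFinrankEq _ _ (by rw [hdim, finrank_fintype_fun_eq_card])
  let M : X → Matrix ι ι ℂ := fun s => LinearMap.toMatrix' (e.toLinearMap ∘ₗ P s)
  have hMv : ∀ s v, (M s).mulVec v = e (P s v) := fun s v => by
    rw [← Matrix.toLin'_apply, Matrix.toLin'_toMatrix']
    rfl
  refine ⟨e, M, ?_, hMv, fun s => ?_⟩
  · refine continuous_matrix fun i j => ?_
    exact hP (Pi.single j 1) (LinearMap.proj i ∘ₗ e.toLinearMap)
  · rw [← Matrix.isUnit_iff_isUnit_det, ← Matrix.mulVec_injective_iff_isUnit]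
    have h1 : (M s).mulVec = e ∘ P s := funext fun v => hMv s v
    rw [h1, e.injective.of_comp_iff]

theorem isOpen_setOf_injective (hdim : finrank ℂ V = Fintype.card ι)
    (hP : ∀ (x : ι → ℂ) (f : V →ₗ[ℂ] ℂ), Continuous fun s => f (P s x)) :
    IsOpen {s | Function.Injective (P s)} := by
  obtain ⟨e, M, hM, -, hinj⟩ := exists_continuous_matrix hdim hP
  simp_rw [← hinj, isUnit_iff_ne_zero]
  exact isOpen_ne_fun hM.matrix_det continuous_const

/-- The inverse of a continuous family of linear isomorphisms is continuous. -/
theorem continuous_of_section (hdim : finrank ℂ V = Fintype.card ι)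
    (hP : ∀ (x : ι → ℂ) (f : V →ₗ[ℂ] ℂ), Continuous fun s => f (P s x))
    {G : X → V → ι → ℂ} (hG : ∀ s y, P s (G s y) = y) (hinj : ∀ s, Function.Injective (P s))
    (y : V) : Continuous fun s => G s y := by
  obtain ⟨e, M, hM, hMv, hunit⟩ := exists_continuous_matrix hdim hP
  have hGM : ∀ s, G s y = ((M s)⁻¹).mulVec (e y) := by
    intro s
    rw [← hG s y, ← hMv, Matrix.mulVec_mulVec, Matrix.nonsing_inv_mul _ ((hunit s).mpr (hinj s)),
      Matrix.one_mulVec, hG s y]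
  simp_rw [hGM]
  refine Continuous.matrix_mulVec ?_ continuous_const
  rw [continuous_iff_continuousAt]
  intro s
  refine (continuousAt_matrix_inv (M s) ?_).comp hM.continuousAt
  exact NormedRing.inverse_continuousAt ((hunit s).mpr (hinj s)).unit

end MatrixFamilies

end Families

/-! ### Lagrangian subspaces and the index of a section -/

section Symplectic

open Module

variable {H : Type*} [AddCommGroup H] [Module ℂ H]

/-- A sesquilinear form `ω` is skew-Hermitian if `ω x y` is minus the complex conjugate of
`ω y x`. -/
def IsSkewHerm (ω : H →ₗ[ℂ] H →ₗ⋆[ℂ] ℂ) : Prop :=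
  ∀ x y, ω x y = -star (ω y x)

theorem IsSkewHerm.eq_zero_comm {ω : H →ₗ[ℂ] H →ₗ⋆[ℂ] ℂ} (hω : IsSkewHerm ω) {x y : H}
    (h : ω x y = 0) : ω y x = 0 := by
  rw [hω, h, star_zero, neg_zero]

variable {W F : Submodule ℂ H}

/-- The form `(w, w') ↦ ω(w, ℓ w')` on `W`. If `ℓ` is a section over `W` of a Lagrangian subspace
along a Lagrangian complement of `W`, it is Hermitian, and it determines that Lagrangian
subspace. -/
def sectionForm (ω : H →ₗ[ℂ] H →ₗ⋆[ℂ] ℂ) (ℓ : W →ₗ[ℂ] H) : W →ₗ[ℂ] W →ₗ⋆[ℂ] ℂ :=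
  (ω ∘ₗ W.subtype).compl₂ ℓ

@[simp] theorem sectionForm_apply (ω : H →ₗ[ℂ] H →ₗ⋆[ℂ] ℂ) (ℓ : W →ₗ[ℂ] H) (w w' : W) :
    sectionForm ω ℓ w w' = ω w (ℓ w') := rfl

/-- The form `(f, f') ↦ ω(π f, f')` on `F`, for a linear map `π` to `W`. -/
def projForm (ω : H →ₗ[ℂ] H →ₗ⋆[ℂ] ℂ) (F : Submodule ℂ H) (π : H →ₗ[ℂ] W) :
    F →ₗ[ℂ] F →ₗ⋆[ℂ] ℂ :=
  (ω ∘ₗ W.subtype ∘ₗ π ∘ₗ F.subtype).compl₂ F.subtype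

@[simp] theorem projForm_apply (ω : H →ₗ[ℂ] H →ₗ⋆[ℂ] ℂ) (F : Submodule ℂ H) (π : H →ₗ[ℂ] W)
    (f f' : F) : projForm ω F π f f' = ω (π f) f' := rfl

variable {Z : Submodule ℂ H}

theorem isHerm_sectionForm {ω : H →ₗ[ℂ] H →ₗ⋆[ℂ] ℂ} (hω : IsSkewHerm ω)
    (hW : ∀ x ∈ W, ∀ y ∈ W, ω x y = 0) (hZ : ∀ x ∈ Z, ∀ y ∈ Z, ω x y = 0)
    {ℓ : W →ₗ[ℂ] H} (hℓ : ∀ w, ℓ w - w ∈ Z) (hL : ∀ w w', ω (ℓ w) (ℓ w') = 0) :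
    IsHerm (sectionForm ω ℓ) := by
  intro w w'
  have h1 := hZ _ (hℓ w) _ (hℓ w')
  have h2 := hW _ w.2 _ w'.2
  simp only [map_sub, LinearMap.sub_apply, hL, h2] at h1
  rw [sectionForm_apply, sectionForm_apply]
  rw [hω (ℓ w) w'] at h1
  linear_combination -h1

theorem sub_projectionOnto_mem (hc : IsCompl W Z) (x : H) : x - W.projectionOnto Z hc x ∈ Z := by
  rw [← Submodule.projectionOnto_apply_eq_zero_iff hc, map_sub,
    Submodule.projectionOnto_apply_left, sub_self]

theorem isHerm_projForm {ω : H →ₗ[ℂ] H →ₗ⋆[ℂ] ℂ} (hω : IsSkewHerm ω) (hc : IsCompl W Z)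
    (hW : ∀ x ∈ W, ∀ y ∈ W, ω x y = 0) (hZ : ∀ x ∈ Z, ∀ y ∈ Z, ω x y = 0)
    (hF : ∀ x ∈ F, ∀ y ∈ F, ω x y = 0) : IsHerm (projForm ω F (W.projectionOnto Z hc)) := by
  intro f f'
  have hz := sub_projectionOnto_mem hc
  have h1 := hZ _ (hz f) _ (hz f')
  have h2 := hW _ (W.projectionOnto Z hc f).2 _ (W.projectionOnto Z hc f').2
  have h3 := hF _ f.2 _ f'.2
  simp only [map_sub, LinearMap.sub_apply, h2, h3] at h1
  rw [projForm_apply, projForm_apply]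
  rw [hω f _] at h1
  linear_combination -h1

/-- The difference on `F` between the form `ω(π f, ℓ (π f'))` of a section and the form
`ω(π f, f')` of `F` itself. Its kernel measures the intersection of `F` with the range of the
section. -/
def relForm (ω : H →ₗ[ℂ] H →ₗ⋆[ℂ] ℂ) (F : Submodule ℂ H) (π : H →ₗ[ℂ] W) (ℓ : W →ₗ[ℂ] H) :
    F →ₗ[ℂ] F →ₗ⋆[ℂ] ℂ :=
  pullback (sectionForm ω ℓ) (π ∘ₗ F.subtype) - projForm ω F π

@[simp] theorem relForm_apply (ω : H →ₗ[ℂ] H →ₗ⋆[ℂ] ℂ) (F : Submodule ℂ H) (π : H →ₗ[ℂ] W)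
    (ℓ : W →ₗ[ℂ] H) (f f' : F) :
    relForm ω F π ℓ f f' = ω (π f) (ℓ (π f')) - ω (π f) f' := rfl

theorem projectionOnto_section (hc : IsCompl W Z) {ℓ : W →ₗ[ℂ] H} (hℓ : ∀ w, ℓ w - w ∈ Z) (w : W) :
    W.projectionOnto Z hc (ℓ w) = w := by
  have := (Submodule.projectionOnto_apply_eq_zero_iff hc).mpr (hℓ w)
  rwa [map_sub, Submodule.projectionOnto_apply_left, sub_eq_zero] at this

theorem isHerm_relForm {ω : H →ₗ[ℂ] H →ₗ⋆[ℂ] ℂ} (hω : IsSkewHerm ω) (hc : IsCompl W Z)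
    (hW : ∀ x ∈ W, ∀ y ∈ W, ω x y = 0) (hZ : ∀ x ∈ Z, ∀ y ∈ Z, ω x y = 0)
    (hF : ∀ x ∈ F, ∀ y ∈ F, ω x y = 0) {ℓ : W →ₗ[ℂ] H} (hℓ : ∀ w, ℓ w - w ∈ Z)
    (hL : ∀ w w', ω (ℓ w) (ℓ w') = 0) : IsHerm (relForm ω F (W.projectionOnto Z hc) ℓ) := by
  intro f f'
  have h1 := isHerm_projForm hω hc hW hZ hF f f'
  have h2 := isHerm_sectionForm hω hW hZ hℓ hL (W.projectionOnto Z hc f)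
    (W.projectionOnto Z hc f')
  simp only [relForm_apply, star_sub]
  simp only [projForm_apply, sectionForm_apply] at h1 h2
  rw [← h1, ← h2]

/-- A vector `g ∈ Z` that is `ω`-orthogonal to the projection of `F` to `W` lies in `F`. -/
theorem mem_of_orthogonal_proj {ω : H →ₗ[ℂ] H →ₗ⋆[ℂ] ℂ} (hω : IsSkewHerm ω) (hc : IsCompl W Z)
    (hZ : ∀ x ∈ Z, ∀ y ∈ Z, ω x y = 0) (hF : perp ω F = F) {g : H} (hg : g ∈ Z)
    (h : ∀ f ∈ F, ω (W.projectionOnto Z hc f) g = 0) : g ∈ F := by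
  rw [← hF]
  intro f hf
  apply hω.eq_zero_comm
  have h1 := hZ _ (sub_projectionOnto_mem hc f) _ hg
  rw [map_sub, LinearMap.sub_apply, h f hf, sub_zero] at h1
  exact h1

theorem map_ker_pullback {h : H →ₗ[ℂ] H →ₗ⋆[ℂ] ℂ} {V : Type*} [AddCommGroup V] [Module ℂ V]
    (f : V →ₗ[ℂ] H) :
    (LinearMap.ker (pullback h f)).map f = LinearMap.range f ⊓ perp h (LinearMap.range f) := by
  ext x
  constructor
  · rintro ⟨y, hy, rfl⟩
    refine ⟨⟨y, rfl⟩, ?_⟩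
    rintro _ ⟨d, rfl⟩
    exact LinearMap.congr_fun (LinearMap.mem_ker.mp hy) d
  · rintro ⟨⟨y, rfl⟩, hx'⟩
    refine ⟨y, ?_, rfl⟩
    rw [SetLike.mem_coe, LinearMap.mem_ker]
    ext d
    exact hx' _ ⟨d, rfl⟩

variable {E : Type*} [AddCommGroup E] [Module ℂ E] [FiniteDimensional ℂ H]

theorem finrank_map_add_finrank_inf_ker (f : H →ₗ[ℂ] E) (S : Submodule ℂ H) :
    finrank ℂ (S.map f) + finrank ℂ ↥(S ⊓ LinearMap.ker f) = finrank ℂ S := by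
  have h1 := LinearMap.finrank_range_add_finrank_ker (f.domRestrict S)
  rw [LinearMap.range_domRestrict, LinearMap.ker_domRestrict] at h1
  rw [← h1, ← Submodule.map_comap_subtype S (LinearMap.ker f),
    finrank_map_of_disjoint_ker S.subtype (by rw [Submodule.ker_subtype]; exact disjoint_bot_right)]

theorem finrank_ker_relForm {ω : H →ₗ[ℂ] H →ₗ⋆[ℂ] ℂ} (hω : IsSkewHerm ω) (hc : IsCompl W Z)
    (hW : ∀ x ∈ W, ∀ y ∈ W, ω x y = 0) (hZ : ∀ x ∈ Z, ∀ y ∈ Z, ω x y = 0)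
    (hF : perp ω F = F) {ℓ : W →ₗ[ℂ] H} (hℓ : ∀ w, ℓ w - w ∈ Z)
    (hL : ∀ w w', ω (ℓ w) (ℓ w') = 0) :
    finrank ℂ (LinearMap.ker (relForm ω F (W.projectionOnto Z hc) ℓ))
      = finrank ℂ ↥(LinearMap.range ℓ ⊓ F)
        + finrank ℂ (LinearMap.ker (W.projectionOnto Z hc ∘ₗ F.subtype)) := by
  have hFF : ∀ x ∈ F, ∀ y ∈ F, ω x y = 0 := fun x hx => by rwa [← hF] at hx
  set π := W.projectionOnto Z hc
  have hh := isHerm_relForm hω hc hW hZ hFF hℓ hL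
  have hmem : ∀ f : F, f ∈ LinearMap.ker (relForm ω F π ℓ) ↔ ℓ (π f) ∈ F := by
    intro f
    have hgZ : ℓ (π f) - f ∈ Z := by
      have := Z.sub_mem (hℓ (π f)) (sub_projectionOnto_mem hc (f : H))
      convert this using 1
      abel
    constructor
    · intro hf
      have : ℓ (π f) - f ∈ F := by
        apply mem_of_orthogonal_proj hω hc hZ hF hgZ
        intro f' hf'
        have := hh.eq_zero_comm (x := f) (y := ⟨f', hf'⟩)
          (by rw [LinearMap.mem_ker.mp hf, LinearMap.zero_apply])
        rw [relForm_apply] at this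
        rw [map_sub]
        exact this
      simpa using F.add_mem this f.2
    · intro hf
      rw [LinearMap.mem_ker]
      ext f'
      apply hh.eq_zero_comm
      rw [relForm_apply, ← map_sub]
      have h1 := hFF _ f'.2 _ (F.sub_mem hf f.2)
      have h2 := hZ _ (sub_projectionOnto_mem hc (f' : H)) _ hgZ
      rw [map_sub ω, LinearMap.sub_apply, h1, zero_sub, neg_eq_zero] at h2
      exact h2
  have h1 := finrank_map_add_finrank_inf_ker (ℓ ∘ₗ π ∘ₗ F.subtype)
    (LinearMap.ker (relForm ω F π ℓ))
  have hℓinj : ∀ w, ℓ w = 0 → w = 0 := fun w hw => by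
    rw [← projectionOnto_section hc hℓ w, hw, map_zero]
  have h2 : (LinearMap.ker (relForm ω F π ℓ)).map (ℓ ∘ₗ π ∘ₗ F.subtype)
      = LinearMap.range ℓ ⊓ F := by
    ext x
    constructor
    · rintro ⟨f, hf, rfl⟩
      exact ⟨⟨π f, rfl⟩, (hmem f).mp hf⟩
    · rintro ⟨⟨w, rfl⟩, hx⟩
      have h3 : π (ℓ w) = w := projectionOnto_section hc hℓ w
      refine ⟨⟨ℓ w, hx⟩, ?_, ?_⟩
      · rw [SetLike.mem_coe, hmem]
        simpa [h3] using hx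
      · simp [h3]
  have h3 : LinearMap.ker (relForm ω F π ℓ) ⊓ LinearMap.ker (ℓ ∘ₗ π ∘ₗ F.subtype)
      = LinearMap.ker (π ∘ₗ F.subtype) := by
    ext f
    constructor
    · rintro ⟨-, hf⟩
      exact hℓinj _ hf
    · intro hf
      have h4 : π f = 0 := hf
      refine ⟨?_, ?_⟩
      · rw [SetLike.mem_coe, hmem, h4, map_zero]
        exact F.zero_mem
      · simp [h4]
  rw [h2, h3] at h1
  exact h1.symm

variable [FiniteDimensional ℂ E]

/-- The index of the section form of a Lagrangian subspace `L = range ℓ`, computed with the help of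
an auxiliary Lagrangian subspace `F`. On `W × F` with the form `sectionForm ⊕ (-projForm)` the
restriction to the copy `{(π f, f)}` of `F` is `relForm`, and the restriction to the orthogonal of
that copy is the form `ω(w, f)` on the vectors `w + f` of `L ∩ (W + F)`. -/
theorem posIndex_sectionForm {ω : H →ₗ[ℂ] H →ₗ⋆[ℂ] ℂ} (hω : IsSkewHerm ω)
    (hnd : ∀ x, (∀ y, ω y x = 0) → x = 0) (hc : IsCompl W Z)
    (hW : ∀ x ∈ W, ∀ y ∈ W, ω x y = 0) (hZ : ∀ x ∈ Z, ∀ y ∈ Z, ω x y = 0)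
    (hF : perp ω F = F) {ℓ : W →ₗ[ℂ] H} (hℓ : ∀ w, ℓ w - w ∈ Z)
    (hL : ∀ w w', ω (ℓ w) (ℓ w') = 0) {q : E →ₗ[ℂ] E →ₗ⋆[ℂ] ℂ} {S : Submodule ℂ E}
    (p : H →ₗ[ℂ] E) (hS : (LinearMap.range ℓ ⊓ (W ⊔ F)).map p = S)
    (hq : ∀ w ∈ W, ∀ f ∈ F, w + f ∈ LinearMap.range ℓ →
      (ω w f).re = (q (p (w + f)) (p (w + f))).re) :
    posIndex (sectionForm ω ℓ) ⊤ + posIndex (-projForm ω F (W.projectionOnto Z hc)) ⊤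
        + finrank ℂ ↥(LinearMap.range ℓ ⊓ W ⊓ F)
      = posIndex (relForm ω F (W.projectionOnto Z hc) ℓ) ⊤ + posIndex q S
        + finrank ℂ ↥(LinearMap.range ℓ ⊓ F) := by
  have hFF : ∀ x ∈ F, ∀ y ∈ F, ω x y = 0 := fun x hx => by rwa [← hF] at hx
  have hkr := finrank_ker_relForm hω hc hW hZ hF hℓ hL
  have hha := isHerm_sectionForm hω hW hZ hℓ hL
  have hhp := isHerm_projForm hω hc hW hZ hFF
  have hsub := sub_projectionOnto_mem hc
  have hproj := projectionOnto_section hc hℓ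
  have horth := fun g hg => mem_of_orthogonal_proj (g := g) hω hc hZ hF hg
  set π := W.projectionOnto Z hc
  let j : F →ₗ[ℂ] W × F := (π ∘ₗ F.subtype).prod LinearMap.id
  have hj1 : ∀ f, (j f).1 = π f := fun _ => rfl
  have hj2 : ∀ f, (j f).2 = f := fun _ => rfl
  have hj : Function.Injective j := fun x y hxy => congrArg Prod.snd hxy
  have hjd : ∀ P : Submodule ℂ F, Disjoint P (LinearMap.ker j) := fun P => by
    rw [LinearMap.ker_eq_bot.mpr hj]
    exact disjoint_bot_right
  set h := directSumForm (sectionForm ω ℓ) (-projForm ω F π) with h_def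
  have hh : IsHerm h := hha.directSumForm hhp.neg
  have h_apply : ∀ x y : W × F, h x y = ω x.1 (ℓ y.1) - ω (π x.2) y.2 := fun x y => by
    simp [h_def, sub_eq_add_neg]
  have hpull : pullback h j = relForm ω F π ℓ := by
    ext x y
    simp [h_apply, j]
  have main := hh.posIndex_eq_perp (LinearMap.range j)
  rw [h_def, posIndex_directSumForm hha hhp.neg, ← h_def] at main
  have e1 : posIndex h (LinearMap.range j) = posIndex (relForm ω F π ℓ) ⊤ := by
    rw [← Submodule.map_top, ← posIndex_map (h := relForm ω F π ℓ) j]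
    intro x _
    rw [← hpull, pullback_apply]
  have e2 : finrank ℂ ↥(LinearMap.range j ⊓ perp h (LinearMap.range j))
      = finrank ℂ (LinearMap.ker (relForm ω F π ℓ)) := by
    rw [← map_ker_pullback, hpull, finrank_map_of_disjoint_ker _ (hjd _)]
  have hsec0 : ∀ w : W, (∀ w', sectionForm ω ℓ w w' = 0) ↔ ℓ w = w := by
    intro w
    constructor
    · intro h0
      rw [← sub_eq_zero]
      apply hnd
      intro y
      have h1 : ω (π y) (ℓ w - w) = 0 := by
        rw [map_sub, hW _ (π y).2 _ w.2, sub_zero]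
        exact hha.eq_zero_comm (h0 (π y))
      have h2 := hZ _ (hsub y) _ (hℓ w)
      rwa [map_sub ω, LinearMap.sub_apply, h1, sub_zero] at h2
    · intro h0 w'
      apply hha.eq_zero_comm
      rw [sectionForm_apply, h0]
      exact hW _ w'.2 _ w.2
  have e3 : finrank ℂ ↥(LinearMap.range j ⊓ LinearMap.ker h)
      = finrank ℂ ↥(LinearMap.range ℓ ⊓ W ⊓ F) + finrank ℂ (LinearMap.ker (π ∘ₗ F.subtype)) := by
    have hmem : ∀ f : F, f ∈ (LinearMap.ker h).comap j ↔ ℓ (π f) = π f ∧ (π f : H) ∈ F := by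
      intro f
      rw [Submodule.mem_comap, LinearMap.mem_ker]
      constructor
      · intro h0
        refine ⟨(hsec0 _).mp fun w' => ?_, ?_⟩
        · have := LinearMap.congr_fun h0 (w', 0)
          simpa [h_apply, j] using this
        · have h1 : (f : H) - π f ∈ F := by
            apply horth _ (hsub f)
            intro f' hf'
            have := LinearMap.congr_fun h0 (0, ⟨f', hf'⟩)
            have h2 : projForm ω F π f ⟨f', hf'⟩ = 0 := by
              simpa [h_apply, j] using this
            have h3 := hhp.eq_zero_comm h2
            rw [projForm_apply] at h3
            rw [map_sub, hW _ (π f').2 _ (π f).2, sub_zero]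
            exact h3
          simpa using F.sub_mem f.2 h1
      · rintro ⟨h0, h1⟩
        ext y
        rw [h_apply]
        have h2 := (hsec0 _).mpr h0 y.1
        rw [sectionForm_apply] at h2
        have h3 := hFF _ h1 _ y.2.2
        simp only [hj1, hj2, h2, h3, sub_zero, LinearMap.zero_apply]
    have h1 : LinearMap.range j ⊓ LinearMap.ker h = ((LinearMap.ker h).comap j).map j := by
      rw [Submodule.map_comap_eq]
    rw [h1, finrank_map_of_disjoint_ker _ (hjd _)]
    have h2 := finrank_map_add_finrank_inf_ker (W.subtype ∘ₗ π ∘ₗ F.subtype)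
      ((LinearMap.ker h).comap j)
    have h3 : ((LinearMap.ker h).comap j).map (W.subtype ∘ₗ π ∘ₗ F.subtype)
        = LinearMap.range ℓ ⊓ W ⊓ F := by
      ext x
      constructor
      · rintro ⟨f, hf, rfl⟩
        have h4 := (hmem f).mp hf
        exact ⟨⟨⟨π f, h4.1⟩, (π f).2⟩, h4.2⟩
      · rintro ⟨⟨⟨w, hw⟩, hxW⟩, hxF⟩
        have h5 : π x = w := by rw [← hw]; exact hproj w
        have h6 : (w : H) = x := by
          rw [Submodule.projectionOnto_apply_of_mem_left hc hxW] at h5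
          rw [← h5]
        refine ⟨⟨x, hxF⟩, ?_, ?_⟩
        · rw [SetLike.mem_coe, hmem]
          simp only [h5, hw, h6]
          exact ⟨trivial, hxF⟩
        · simp only [LinearMap.comp_apply, Submodule.subtype_apply, h5, h6]
    have h4 : (LinearMap.ker h).comap j ⊓ LinearMap.ker (W.subtype ∘ₗ π ∘ₗ F.subtype)
        = LinearMap.ker (π ∘ₗ F.subtype) := by
      ext f
      constructor
      · rintro ⟨-, hf⟩
        exact Subtype.ext hf
      · intro hf
        have h5 : π f = 0 := hf
        refine ⟨?_, ?_⟩
        · rw [SetLike.mem_coe, hmem, h5]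
          simp
        · simp [h5]
    rw [h3, h4] at h2
    exact h2.symm
  have e4 : posIndex h (perp h (LinearMap.range j)) = posIndex q S := by
    -- A vector `(w, f)` of the orthogonal corresponds to `ℓ w = (w - π f) + f'` with `f' ∈ F`.
    have hkey : ∀ x ∈ perp h (LinearMap.range j), ℓ x.1 - (x.1 - π x.2) ∈ F ∧
        h x x = ω (x.1 - π x.2) (ℓ x.1 - (x.1 - π x.2)) := by
      rintro ⟨w, f⟩ hx
      have hg : ℓ w - w - ((f : H) - π f) ∈ Z := Z.sub_mem (hℓ w) (hsub f)
      have hgF : ℓ w - w - ((f : H) - π f) ∈ F := by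
        apply horth _ hg
        intro f' hf'
        have h1 := hh.eq_zero_comm (hx _ ⟨⟨f', hf'⟩, rfl⟩)
        rw [h_apply] at h1
        simp only [hj1, hj2] at h1
        simp only [map_sub, hW _ (π f').2 _ w.2, hW _ (π f').2 _ (π f).2, sub_zero]
        exact h1
      have hF' : ℓ w - (w - π f) ∈ F := by
        have := F.add_mem hgF f.2
        convert this using 1
        abel
      refine ⟨hF', ?_⟩
      rw [h_apply]
      have h1 := hFF _ f.2 _ hgF
      have h2 := hZ _ (hsub f) _ hg
      rw [map_sub ω, LinearMap.sub_apply, h1, zero_sub, neg_eq_zero] at h2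
      simp only [map_sub, hW _ (π f).2 _ w.2, hW _ (π f).2 _ (π f).2, sub_zero] at h2
      simp only [map_sub, LinearMap.sub_apply, hW _ (π f).2 _ w.2, hW _ (π f).2 _ (π f).2,
        hW _ w.2 _ w.2, hW _ w.2 _ (π f).2]
      linear_combination h2
    rw [posIndex_map (h' := q) (p ∘ₗ ℓ ∘ₗ LinearMap.fst ℂ W F)]
    · congr 1
      rw [Submodule.map_comp, ← hS]
      congr 1
      ext x
      constructor
      · rintro ⟨y, hy, rfl⟩
        refine ⟨⟨y.1, rfl⟩, ?_⟩
        have := Submodule.add_mem_sup (W.sub_mem y.1.2 (π y.2).2) (hkey y hy).1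
        simpa using this
      · rintro ⟨⟨w, rfl⟩, hx⟩
        obtain ⟨w₀, hw₀, f, hf, hsum⟩ := Submodule.mem_sup.mp hx
        refine ⟨(w, ⟨f, hf⟩), ?_, rfl⟩
        have h1 : (π f : H) = w - w₀ := by
          have h2 : π (w₀ + f) = w := by rw [hsum]; exact hproj w
          rw [map_add, Submodule.projectionOnto_apply_of_mem_left hc hw₀] at h2
          rw [← h2]
          simp
        rintro _ ⟨f', rfl⟩
        apply hh.eq_zero_comm
        rw [h_apply]
        simp only [hj1, hj2]
        rw [← hsum, map_add, hW _ (π f').2 _ hw₀]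
        ring
    · intro x hx
      obtain ⟨h1, h2⟩ := hkey x hx
      rw [h2, hq _ (W.sub_mem x.1.2 (π x.2).2) _ h1 (by simp)]
      simp
  rw [e1, e2, e3, e4] at main
  omega

end Symplectic

/-! ### Counting eigenvalues of unitary maps in an arc -/

section Spectral

open Module Complex

variable {E : Type*} [AddCommGroup E] [Module ℂ E]

/-- The form `i (1 - ζ)⁻¹ ρ((B - ζ) x, (1 - B) y)` attached to a unitary `B` of a Hermitian
space `(E, ρ)`. On an eigenvector of `B` with eigenvalue `exp (i φ)`, for `ζ = exp (-i θ)`, it is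
`-2 sin ((φ + θ) / 2) sin (φ / 2) / sin (θ / 2)` times `ρ`, which is positive exactly on the arc
`-θ < φ < 0`. -/
noncomputable def arcForm (ρ : E →ₗ[ℂ] E →ₗ⋆[ℂ] ℂ) (B : End ℂ E) (ζ : ℂ) :
    E →ₗ[ℂ] E →ₗ⋆[ℂ] ℂ :=
  (-I * (1 - ζ)⁻¹) • (ρ ∘ₗ (B - ζ • LinearMap.id)).compl₂ (B - LinearMap.id)

theorem arcForm_apply (ρ : E →ₗ[ℂ] E →ₗ⋆[ℂ] ℂ) (B : End ℂ E) (ζ : ℂ) (x y : E) :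
    arcForm ρ B ζ x y = -I * (1 - ζ)⁻¹ * ρ (B x - ζ • x) (B y - y) := rfl

variable {ρ : E →ₗ[ℂ] E →ₗ⋆[ℂ] ℂ} {B : End ℂ E}

theorem arcForm_apply_eigen {ζ μ ν : ℂ} {x y : E} (hx : B x = μ • x) (hy : B y = ν • y) :
    arcForm ρ B ζ x y = -I * (μ - ζ) * (star ν - 1) * (1 - ζ)⁻¹ * ρ x y := by
  rw [arcForm_apply, hx, hy]
  simp only [map_sub, map_smul, LinearMap.sub_apply, LinearMap.smul_apply, map_smulₛₗ, smul_eq_mul,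
    starRingEnd_apply]
  ring

theorem norm_eq_one_of_eigen (hpos : ∀ x, x ≠ 0 → 0 < (ρ x x).re)
    (hB : ∀ x y, ρ (B x) (B y) = ρ x y) {μ : ℂ} {x : E} (hx : B x = μ • x) (hx0 : x ≠ 0) :
    ‖μ‖ = 1 := by
  have h1 := hB x x
  rw [hx] at h1
  simp only [map_smul, LinearMap.smul_apply, map_smulₛₗ, smul_eq_mul] at h1
  rw [← mul_assoc, ← normSq_eq_conj_mul_self] at h1
  have h2 := congrArg re h1
  rw [re_ofReal_mul] at h2
  have h3 : normSq μ = 1 := by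
    have := (hpos x hx0).ne'
    field_simp at h2
    exact h2
  rw [normSq_eq_norm_sq] at h3
  exact (pow_eq_one_iff_of_nonneg (norm_nonneg μ) two_ne_zero).mp h3

theorem ortho_of_eigen (hpos : ∀ x, x ≠ 0 → 0 < (ρ x x).re)
    (hB : ∀ x y, ρ (B x) (B y) = ρ x y) {μ ν : ℂ} (hμν : μ ≠ ν) {x y : E} (hx : B x = μ • x)
    (hy : B y = ν • y) : ρ x y = 0 := by
  by_cases hy0 : y = 0
  · rw [hy0, map_zero]
  have hν := norm_eq_one_of_eigen hpos hB hy hy0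
  have h1 := hB x y
  rw [hx, hy] at h1
  simp only [map_smul, LinearMap.smul_apply, map_smulₛₗ, smul_eq_mul] at h1
  have h2 : ν * (starRingEnd ℂ) ν = 1 := by
    rw [mul_conj, normSq_eq_norm_sq, hν]
    simp
  have h3 : (μ - ν) * ρ x y = 0 := by
    linear_combination ν * h1 - μ * ρ x y * h2
  exact (mul_eq_zero.mp h3).resolve_left (sub_ne_zero.mpr hμν)

variable [FiniteDimensional ℂ E]

theorem maxGenEigenspace_eq_of_unitary (hh : IsHerm ρ) (hpos : ∀ x, x ≠ 0 → 0 < (ρ x x).re)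
    (hB : ∀ x y, ρ (B x) (B y) = ρ x y) (μ : ℂ) :
    B.maxGenEigenspace μ = B.eigenspace μ := by
  have hinj : Function.Injective B := by
    rw [injective_iff_map_eq_zero]
    intro x hx
    by_contra hx0
    have h1 := hpos x hx0
    rw [← hB, hx] at h1
    simp at h1
  have hss : B.IsSemisimple := by
    rw [Module.End.isSemisimple_iff]
    intro p hp
    have hdis : Disjoint p (perp ρ p) := by
      rw [Submodule.disjoint_def]
      intro x hx hx'
      by_contra hx0
      have h1 := hpos x hx0
      rw [hx' x hx] at h1
      simp at h1
    refine ⟨perp ρ p, ?_, hdis, ?_⟩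
    · have hmap : p.map B = p := by
        apply Submodule.eq_of_le_of_finrank_eq (Submodule.map_le_iff_le_comap.mpr hp)
        exact finrank_map_of_disjoint_ker B (by
          rw [LinearMap.ker_eq_bot.mpr hinj]
          exact disjoint_bot_right)
      intro x hx d hd
      rw [← hmap] at hd
      obtain ⟨d, hd, rfl⟩ := hd
      rw [hB]
      exact hx d hd
    · rw [codisjoint_iff]
      apply Submodule.eq_top_of_finrank_eq
      have h1 := Submodule.finrank_sup_add_finrank_inf_eq p (perp ρ p)
      rw [hdis.eq_bot, finrank_bot] at h1
      have h2 := hh.finrank_perp p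
      have h3 := Submodule.finrank_le (p ⊔ perp ρ p)
      omega
  exact hss.isFinitelySemisimple.maxGenEigenspace_eq_eigenspace μ

/-- A vector of a spectral subspace of a unitary map is an orthogonal sum of eigenvectors. -/
theorem exists_sum_of_mem_spectralSubspace (hh : IsHerm ρ) (hpos : ∀ x, x ≠ 0 → 0 < (ρ x x).re)
    (hB : ∀ x y, ρ (B x) (B y) = ρ x y) {N : Set ℂ} {x : E} (hx : x ∈ spectralSubspace B N)
    (ζ : ℂ) :
    ∃ (s : Finset ℂ) (v : ℂ → E), x = ∑ μ ∈ s, v μ ∧ (∀ μ ∈ s, μ ∈ N ∧ B (v μ) = μ • v μ) ∧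
      arcForm ρ B ζ x x = ∑ μ ∈ s, -I * (μ - ζ) * (star μ - 1) * (1 - ζ)⁻¹ * ρ (v μ) (v μ) := by
  classical
  simp only [spectralSubspace, maxGenEigenspace_eq_of_unitary hh hpos hB] at hx
  rw [iSup_subtype', Submodule.mem_iSup_iff_exists_finsupp] at hx
  obtain ⟨f, hf, rfl⟩ := hx
  have hf' : ∀ μ : N, B (f μ) = (μ : ℂ) • f μ := fun μ => Module.End.mem_eigenspace_iff.mp (hf μ)
  have hinj : ∀ a ∈ f.support, ∀ b ∈ f.support, (a : ℂ) = (b : ℂ) → a = b :=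
    fun _ _ _ _ hab => Subtype.ext hab
  refine ⟨f.support.image Subtype.val, fun μ => if hμ : μ ∈ N then f ⟨μ, hμ⟩ else 0, ?_, ?_, ?_⟩
  · rw [Finset.sum_image hinj, Finsupp.sum]
    simp
  · intro μ hμ
    obtain ⟨ν, -, rfl⟩ := Finset.mem_image.mp hμ
    refine ⟨ν.2, ?_⟩
    simpa using hf' ν
  · rw [Finset.sum_image hinj, Finsupp.sum, map_sum]
    refine Finset.sum_congr rfl fun μ hμ => ?_
    rw [map_sum, LinearMap.sum_apply, Finset.sum_eq_single μ]
    · rw [arcForm_apply_eigen (hf' μ) (hf' μ)]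
      simp
    · intro ν _ hνμ
      rw [arcForm_apply_eigen (hf' ν) (hf' μ), ortho_of_eigen hpos hB _ (hf' ν) (hf' μ), mul_zero]
      exact fun h => hνμ (Subtype.ext h)
    · exact fun h => absurd hμ h

theorem arc_coefficient {θ : ℝ} (hθ : 0 < θ ∧ θ < Real.pi) (φ : ℝ) :
    -I * (exp (φ * I) - exp (-(θ * I))) * (star (exp (φ * I)) - 1) * (1 - exp (-(θ * I)))⁻¹
      = ((-2 * Real.sin ((φ + θ) / 2) * Real.sin (φ / 2) / Real.sin (θ / 2) : ℝ) : ℂ) := by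
  have hs : Real.sin (θ / 2) ≠ 0 :=
    (Real.sin_pos_of_pos_of_lt_pi (by linarith) (by linarith)).ne'
  set a := exp (φ / 2 * I) with ha
  set b := exp (θ / 2 * I) with hb
  have ha0 : a ≠ 0 := exp_ne_zero _
  have hb0 : b ≠ 0 := exp_ne_zero _
  have e1 : exp (φ * I) = a * a := by rw [ha, ← exp_add]; congr 1; ring
  have e2 : star (exp (φ * I)) = a⁻¹ * a⁻¹ := by
    rw [ha, ← exp_neg, ← exp_add, ← starRingEnd_apply, ← exp_conj]
    congr 1
    simp only [map_mul, conj_ofReal, conj_I]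
    ring
  have e3 : exp (-(θ * I)) = b⁻¹ * b⁻¹ := by
    rw [hb, ← exp_neg, ← exp_add]; congr 1; ring
  have s1 : ((Real.sin (φ / 2) : ℝ) : ℂ) = (a⁻¹ - a) * I / 2 := by
    rw [ofReal_sin, Complex.sin, ha, ← exp_neg]
    push_cast
    rw [neg_mul]
  have s2 : ((Real.sin (θ / 2) : ℝ) : ℂ) = (b⁻¹ - b) * I / 2 := by
    rw [ofReal_sin, Complex.sin, hb, ← exp_neg]
    push_cast
    rw [neg_mul]
  have s3 : ((Real.sin ((φ + θ) / 2) : ℝ) : ℂ) = (a⁻¹ * b⁻¹ - a * b) * I / 2 := by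
    rw [ofReal_sin, Complex.sin, ha, hb, ← exp_neg, ← exp_neg, ← exp_add, ← exp_add]
    push_cast
    congr 4 <;> ring
  have hs' : (b⁻¹ - b) * I / 2 ≠ 0 := by
    rw [← s2]
    exact_mod_cast hs
  have hb1 : b⁻¹ - b ≠ 0 := by
    intro h
    rw [h] at hs'
    simp at hs'
  have hb2 : 1 - b⁻¹ * b⁻¹ ≠ 0 := by
    intro h
    apply hb1
    field_simp at h ⊢
    linear_combination -h
  push_cast [s1, s2, s3]
  rw [e2, e1, e3, ← div_eq_mul_inv, div_eq_div_iff hb2 hs']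
  field_simp
  ring_nf

/-- The number of eigenvalues of a unitary map in the arc `-θ < φ < 0` is the positive index of
its arc form at `exp (-i θ)`. -/
theorem finrank_spectralSubspace_lowerArc (hh : IsHerm ρ) (hpos : ∀ x, x ≠ 0 → 0 < (ρ x x).re)
    (hB : ∀ x y, ρ (B x) (B y) = ρ x y) {θ : ℝ} (hθ : 0 < θ ∧ θ < Real.pi) :
    finrank ℂ (spectralSubspace B (lowerArc θ)) = posIndex (arcForm ρ B (exp (-(θ * I)))) ⊤ := by
  have hs : 0 < Real.sin (θ / 2) :=
    Real.sin_pos_of_pos_of_lt_pi (by linarith [hθ.1]) (by linarith [hθ.1, hθ.2])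
  have hρ : ∀ x, 0 ≤ (ρ x x).re := fun x => by
    by_cases hx : x = 0
    · simp [hx]
    · exact (hpos x hx).le
  symm
  apply posIndex_eq_of_decomp (N := spectralSubspace B (lowerArc θ)ᶜ) le_top le_top
  · rw [← Module.End.iSup_maxGenEigenspace_eq_top B]
    refine iSup_le fun μ => ?_
    by_cases hμ : μ ∈ lowerArc θ
    · exact le_sup_of_le_left (le_biSup (fun z => B.maxGenEigenspace z) hμ)
    · exact le_sup_of_le_right (le_biSup (fun z => B.maxGenEigenspace z) (s := (lowerArc θ)ᶜ) hμ)
  · intro x hx hx0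
    obtain ⟨s, v, hsum, hv, hval⟩ :=
      exists_sum_of_mem_spectralSubspace hh hpos hB hx (exp (-(θ * I)))
    rw [hval, re_sum]
    have hcoef : ∀ μ ∈ s, ∃ c : ℝ, 0 < c ∧
        (-I * (μ - exp (-(θ * I))) * (star μ - 1) * (1 - exp (-(θ * I)))⁻¹ * ρ (v μ) (v μ)).re
          = c * (ρ (v μ) (v μ)).re := by
      intro μ hμ
      obtain ⟨φ, h1, h2, rfl⟩ := (hv μ hμ).1
      rw [arc_coefficient hθ, re_ofReal_mul]
      refine ⟨_, ?_, rfl⟩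
      have h3 : 0 < Real.sin ((φ + θ) / 2) :=
        Real.sin_pos_of_pos_of_lt_pi (by linarith) (by linarith [hθ.2])
      have h4 : Real.sin (φ / 2) < 0 :=
        Real.sin_neg_of_neg_of_neg_pi_lt (by linarith) (by linarith [hθ.2])
      exact div_pos (by nlinarith) hs
    apply Finset.sum_pos'
    · intro μ hμ
      obtain ⟨c, hc, h⟩ := hcoef μ hμ
      rw [h]
      exact mul_nonneg hc.le (hρ _)
    · by_contra! hall
      apply hx0
      rw [hsum]
      refine Finset.sum_eq_zero fun μ hμ => ?_
      by_contra hne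
      obtain ⟨c, hc, h⟩ := hcoef μ hμ
      have h1 := hall μ hμ
      rw [h] at h1
      exact h1.not_gt (mul_pos hc (hpos _ hne))
  · intro x hx
    obtain ⟨s, v, hsum, hv, hval⟩ :=
      exists_sum_of_mem_spectralSubspace hh hpos hB hx (exp (-(θ * I)))
    rw [hval, re_sum]
    refine Finset.sum_nonpos fun μ hμ => ?_
    by_cases hv0 : v μ = 0
    · simp [hv0]
    have hμ1 := norm_eq_one_of_eigen hpos hB (hv μ hμ).2 hv0
    have hμ2 : μ = exp (μ.arg * I) := by
      conv_lhs => rw [← norm_mul_exp_arg_mul_I μ, hμ1]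
      simp
    have hμ3 := (hv μ hμ).1
    have hlt := neg_pi_lt_arg μ
    have hle := arg_le_pi μ
    generalize μ.arg = φ at hμ2 hlt hle
    rw [hμ2, arc_coefficient hθ, re_ofReal_mul]
    refine mul_nonpos_of_nonpos_of_nonneg (div_nonpos_of_nonpos_of_nonneg ?_ hs.le) (hρ _)
    rcases le_or_gt 0 φ with h0 | h0
    · have h3 : 0 ≤ Real.sin ((φ + θ) / 2) :=
        Real.sin_nonneg_of_nonneg_of_le_pi (by linarith [hθ.1]) (by linarith [hθ.2])
      have h4 : 0 ≤ Real.sin (φ / 2) :=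
        Real.sin_nonneg_of_nonneg_of_le_pi (by linarith) (by linarith)
      nlinarith [mul_nonneg h3 h4]
    · have h1 : φ ≤ -θ := by
        by_contra! h1
        exact hμ3 ⟨φ, h1, h0, hμ2⟩
      have h3 : Real.sin ((φ + θ) / 2) ≤ 0 :=
        Real.sin_nonpos_of_nonpos_of_neg_pi_le (by linarith) (by linarith [hθ.1])
      have h4 : Real.sin (φ / 2) ≤ 0 :=
        Real.sin_nonpos_of_nonpos_of_neg_pi_le (by linarith) (by linarith)
      nlinarith [mul_nonneg_of_nonpos_of_nonpos h3 h4]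

end Spectral

/-! ### Symplectic splittings and graphs of unitary maps -/

section Splitting

open Module Complex

variable {H : Type*} [AddCommGroup H] [Module ℂ H] {ω : H →ₗ[ℂ] H →ₗ⋆[ℂ] ℂ}
  {Hp Hm L W : Submodule ℂ H}

namespace MaslovType.IsSymplecticSplitting

theorem orthogonal' (h : IsSymplecticSplitting ω Hp Hm) (hω : IsSkewHerm ω) (x : Hp) (y : Hm) :
    ω y x = 0 :=
  hω.eq_zero_comm (h.orthogonal x x.2 y y.2)

theorem add_inj (h : IsSymplecticSplitting ω Hp Hm) {x x' : Hp} {y y' : Hm}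
    (he : (x + y : H) = x' + y') : x = x' ∧ y = y' := by
  have h1 := congrArg (Hp.projectionOnto Hm h.isCompl) he
  have h2 := congrArg (Hm.projectionOnto Hp h.isCompl.symm) he
  simp only [map_add, Submodule.projectionOnto_apply_left, Submodule.projectionOnto_apply_right,
    add_zero, zero_add] at h1 h2
  exact ⟨h1, h2⟩

theorem apply_add (h : IsSymplecticSplitting ω Hp Hm) (hω : IsSkewHerm ω) (x x' : Hp)
    (y y' : Hm) : ω (x + y) (x' + y') = ω x x' + ω y y' := by
  simp only [map_add, LinearMap.add_apply, h.orthogonal x x.2 y' y'.2, h.orthogonal' hω]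
  ring

end MaslovType.IsSymplecticSplitting

/-- The subspace `{x + ζ V x}`. For `|ζ| = 1` it is the Lagrangian subspace generated by `ζ V`. -/
def rotGraph (V : Hp ≃ₗ[ℂ] Hm) (ζ : ℂ) : Submodule ℂ H :=
  LinearMap.range (Hp.subtype + ζ • (Hm.subtype ∘ₗ V.toLinearMap))

theorem mem_rotGraph {V : Hp ≃ₗ[ℂ] Hm} {ζ : ℂ} {z : H} :
    z ∈ rotGraph V ζ ↔ ∃ x : Hp, z = x + (ζ • V x : Hm) :=
  ⟨fun ⟨x, hx⟩ => ⟨x, by rw [← hx]; simp⟩, fun ⟨x, hx⟩ => ⟨x, by rw [hx]; simp⟩⟩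

theorem rotGraph_isotropic (h : IsSymplecticSplitting ω Hp Hm) (hω : IsSkewHerm ω)
    {V : Hp ≃ₗ[ℂ] Hm} (hV : ∀ x y : Hp, ω (V x) (V y) = -ω x y) {ζ : ℂ} (hζ : ‖ζ‖ = 1) :
    ∀ x ∈ rotGraph V ζ, ∀ y ∈ rotGraph V ζ, ω x y = 0 := by
  intro x hx y hy
  obtain ⟨x, rfl⟩ := mem_rotGraph.mp hx
  obtain ⟨y, rfl⟩ := mem_rotGraph.mp hy
  rw [h.apply_add hω]
  have h1 : ζ * (starRingEnd ℂ) ζ = 1 := by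
    rw [mul_conj, normSq_eq_norm_sq, hζ]
    simp
  simp only [Submodule.coe_smul, map_smul, LinearMap.smul_apply, map_smulₛₗ, smul_eq_mul, hV]
  linear_combination (-ω x y) * h1

theorem finrank_rotGraph (h : IsSymplecticSplitting ω Hp Hm) (V : Hp ≃ₗ[ℂ] Hm) (ζ : ℂ) :
    finrank ℂ (rotGraph V ζ) = finrank ℂ Hp := by
  apply LinearMap.finrank_range_of_inj
  intro x y hxy
  have h1 : (x + (ζ • V x : Hm) : H) = y + (ζ • V y : Hm) := by simpa using hxy
  exact (h.add_inj h1).1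

namespace MaslovType.Generates

theorem eq_rotGraph {V : Hp ≃ₗ[ℂ] Hm} (hV : Generates ω V W) : W = rotGraph V 1 := by
  ext z
  rw [hV.2, mem_rotGraph]
  simp

theorem mem {V : Hp ≃ₗ[ℂ] Hm} (hV : Generates ω V W) (x : Hp) : (x + V x : H) ∈ W :=
  (hV.2 _).mpr ⟨x, rfl⟩

theorem isotropic (h : IsSymplecticSplitting ω Hp Hm) (hω : IsSkewHerm ω)
    {V : Hp ≃ₗ[ℂ] Hm} (hV : Generates ω V W) : ∀ x ∈ W, ∀ y ∈ W, ω x y = 0 := by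
  rw [hV.eq_rotGraph]
  exact rotGraph_isotropic h hω hV.1 norm_one

theorem finrank_eq (h : IsSymplecticSplitting ω Hp Hm) {V : Hp ≃ₗ[ℂ] Hm}
    (hV : Generates ω V W) : finrank ℂ W = finrank ℂ Hp := by
  rw [hV.eq_rotGraph]
  exact finrank_rotGraph h V 1

theorem unique (h : IsSymplecticSplitting ω Hp Hm) {V V' : Hp ≃ₗ[ℂ] Hm}
    (hV : Generates ω V W) (hV' : Generates ω V' W) : V = V' := by
  ext x
  obtain ⟨x', hx'⟩ := (hV'.2 _).mp (hV.mem x)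
  obtain ⟨h1, h2⟩ := h.add_inj hx'
  rw [h2, h1]

end MaslovType.Generates

variable [FiniteDimensional ℂ H]

theorem finrank_eq_two_mul (h : IsSymplecticSplitting ω Hp Hm) (V : Hp ≃ₗ[ℂ] Hm) :
    finrank ℂ H = 2 * finrank ℂ Hp := by
  rw [← Submodule.finrank_add_eq_of_isCompl h.isCompl, ← V.finrank_eq, two_mul]

theorem notMem_spectrum_iff (U V : Hp ≃ₗ[ℂ] Hm) (ζ : ℂ) :
    ζ ∉ spectrum ℂ (U.toLinearMap ∘ₗ V.symm.toLinearMap : Module.End ℂ Hm) ↔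
      ∀ x, U x = ζ • V x → x = 0 := by
  rw [← Module.End.hasEigenvalue_iff_mem_spectrum]
  constructor
  · intro h x hx
    by_contra hx0
    apply h
    apply Module.End.hasEigenvalue_of_hasEigenvector (x := V x)
    rw [Module.End.hasEigenvector_iff, Module.End.mem_eigenspace_iff]
    exact ⟨by simpa using hx, by simpa using hx0⟩
  · intro h hev
    obtain ⟨y, hy⟩ := hev.exists_hasEigenvector
    have h1 := h (V.symm y) (by simpa using hy.apply_eq_smul)
    exact hy.2 (by simpa using h1)

theorem isCompl_of_disjoint (h : IsSymplecticSplitting ω Hp Hm) (V : Hp ≃ₗ[ℂ] Hm)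
    {A B : Submodule ℂ H} (hA : finrank ℂ A = finrank ℂ Hp) (hB : finrank ℂ B = finrank ℂ Hp)
    (hAB : Disjoint A B) : IsCompl A B := by
  refine ⟨hAB, ?_⟩
  rw [codisjoint_iff]
  apply Submodule.eq_top_of_finrank_eq
  have h1 := Submodule.finrank_sup_add_finrank_inf_eq A B
  rw [hAB.eq_bot, finrank_bot] at h1
  have h2 := finrank_eq_two_mul h V
  omega

theorem disjoint_rotGraph (h : IsSymplecticSplitting ω Hp Hm) {U V : Hp ≃ₗ[ℂ] Hm}
    (hU : Generates ω U L) {ζ : ℂ}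
    (hζ : ζ ∉ spectrum ℂ (U.toLinearMap ∘ₗ V.symm.toLinearMap : Module.End ℂ Hm)) :
    Disjoint L (rotGraph V ζ) := by
  rw [Submodule.disjoint_def]
  intro z hz hz'
  obtain ⟨x, rfl⟩ := (hU.2 z).mp hz
  obtain ⟨y, hy⟩ := mem_rotGraph.mp hz'
  obtain ⟨rfl, h2⟩ := h.add_inj hy
  have := (notMem_spectrum_iff U V ζ).mp hζ x h2
  simp [this]

theorem isCompl_rotGraph (h : IsSymplecticSplitting ω Hp Hm) {V : Hp ≃ₗ[ℂ] Hm}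
    (hV : Generates ω V W) {ζ : ℂ} (hζ : ζ ≠ 1) : IsCompl W (rotGraph V ζ) := by
  refine isCompl_of_disjoint h V (hV.finrank_eq h) (finrank_rotGraph h V ζ) ?_
  apply disjoint_rotGraph h hV
  rw [notMem_spectrum_iff]
  intro x hx
  have h1 : (1 - ζ) • V x = 0 := by rw [sub_smul, one_smul, sub_eq_zero]; exact hx
  simpa [sub_ne_zero.mpr hζ.symm] using h1

/-- A subspace transversal to `Z`, of the dimension of a complement `W` of `Z`, is the range of a
section over `W`. -/
theorem exists_section {Z : Submodule ℂ H} (hc : IsCompl W Z) (hL : Disjoint L Z)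
    (hd : finrank ℂ L = finrank ℂ W) :
    ∃ ℓ : W →ₗ[ℂ] H, LinearMap.range ℓ = L ∧ ∀ w, ℓ w - w ∈ Z := by
  let π := W.projectionOnto Z hc
  have hinj : Function.Injective (π ∘ₗ L.subtype) := by
    rw [injective_iff_map_eq_zero]
    intro x hx
    have h1 : (x : H) ∈ Z := (Submodule.projectionOnto_apply_eq_zero_iff hc).mp hx
    exact Subtype.ext (Submodule.disjoint_def.mp hL x x.2 h1)
  let e := LinearEquiv.ofInjectiveOfFinrankEq (π ∘ₗ L.subtype) hinj hd
  refine ⟨L.subtype ∘ₗ e.symm.toLinearMap, ?_, fun w => ?_⟩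
  · rw [LinearMap.range_comp, LinearEquiv.range, Submodule.map_top, Submodule.range_subtype]
  · have h1 : π (e.symm w) = w := e.apply_symm_apply w
    have h2 := sub_projectionOnto_mem hc (e.symm w : H)
    rw [show W.projectionOnto Z hc (e.symm w : H) = w from h1] at h2
    exact h2

/-- Parametrizing `L` and `W` by `H⁻`, the section form of `L` over `W` along `{x + ζ V x}`
becomes the arc form of `U V⁻¹` at `ζ`, so its index counts eigenvalues of `U V⁻¹`. -/
theorem finrank_spectralSubspace_eq_posIndex (h : IsSymplecticSplitting ω Hp Hm)
    (hω : IsSkewHerm ω) {U V : Hp ≃ₗ[ℂ] Hm} (hU : Generates ω U L) (hV : Generates ω V W)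
    {θ : ℝ} (hθ : 0 < θ ∧ θ < Real.pi) (hc : IsCompl W (rotGraph V (exp (-(θ * I)))))
    {ℓ : W →ₗ[ℂ] H} (hℓL : LinearMap.range ℓ = L)
    (hℓ : ∀ w, ℓ w - w ∈ rotGraph V (exp (-(θ * I)))) (hζ1 : exp (-(θ * I)) ≠ 1) :
    finrank ℂ (spectralSubspace (U.toLinearMap ∘ₗ V.symm.toLinearMap : Module.End ℂ Hm)
      (lowerArc θ)) = posIndex (sectionForm ω ℓ) ⊤ := by
  set ζ := exp (-(θ * I)) with hζ
  let B : Module.End ℂ Hm := U.toLinearMap ∘ₗ V.symm.toLinearMap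
  have hBx : ∀ y, B y = U (V.symm y) := fun _ => rfl
  let ρ : Hm →ₗ[ℂ] Hm →ₗ⋆[ℂ] ℂ := I • pullback ω Hm.subtype
  have hρ : ∀ x y, ρ x y = I * ω x y := fun _ _ => rfl
  have hh : IsHerm ρ := fun x y => by
    rw [hρ, hρ, hω x y, star_mul']
    simp
  have hpos : ∀ x, x ≠ 0 → 0 < (ρ x x).re := fun x hx => by
    have h1 := h.neg x x.2 (by simpa using hx)
    rw [neg_mul, neg_re, neg_lt_zero] at h1
    exact h1
  have hB : ∀ x y, ρ (B x) (B y) = ρ x y := fun x y => by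
    rw [hρ, hρ, hBx, hBx, hU.1]
    have := hV.1 (V.symm x) (V.symm y)
    rw [V.apply_symm_apply, V.apply_symm_apply] at this
    rw [this]
  rw [show (U.toLinearMap ∘ₗ V.symm.toLinearMap : Module.End ℂ Hm) = B from rfl,
    finrank_spectralSubspace_lowerArc hh hpos hB hθ, ← hζ]
  let π := W.projectionOnto (rotGraph V ζ) hc
  let m : Hm →ₗ[ℂ] H := Hp.subtype ∘ₗ V.symm.toLinearMap + Hm.subtype ∘ₗ B
  have hm : ∀ y, m y = V.symm y + B y := fun _ => rfl
  have hmL : ∀ y, m y ∈ L := fun y => hU.mem (V.symm y)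
  have hζ0 : 1 - ζ ≠ 0 := sub_ne_zero.mpr hζ1.symm
  have hπℓ : ∀ w, π (ℓ w) = w := projectionOnto_section hc hℓ
  rw [posIndex_map (h' := sectionForm ω ℓ) (π ∘ₗ m)]
  · congr 1
    rw [Submodule.map_top, LinearMap.range_eq_top]
    intro w
    obtain ⟨x, hx⟩ := (hU.2 (ℓ w)).mp (by rw [← hℓL]; exact ⟨w, rfl⟩)
    refine ⟨V x, ?_⟩
    rw [LinearMap.comp_apply, hm, hBx, V.symm_apply_apply, ← hx, hπℓ]
  · intro y _
    obtain ⟨w', hw'⟩ : m y ∈ LinearMap.range ℓ := by rw [hℓL]; exact hmL y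
    have h1 : ℓ (π (m y)) = m y := by rw [← hw', hπℓ]
    -- The component of `m y` in `W` is `V⁻¹ u + u`.
    set u : Hm := (1 - ζ)⁻¹ • (B y - ζ • y) with hu
    have hw : (V.symm u + u : H) ∈ W := by simpa using hV.mem (V.symm u)
    have hz : m y - (V.symm u + u : H) ∈ rotGraph V ζ := by
      rw [mem_rotGraph]
      refine ⟨V.symm y - V.symm u, ?_⟩
      have h2 : B y - u = ζ • V (V.symm y - V.symm u) := by
        rw [← map_sub, V.apply_symm_apply]
        have h3 : (1 - ζ) • u = B y - ζ • y := by rw [hu, smul_inv_smul₀ hζ0]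
        rw [sub_smul, one_smul] at h3
        rw [smul_sub, sub_eq_sub_iff_add_eq_add]
        rw [sub_eq_sub_iff_add_eq_add] at h3
        rw [← h3]
        abel
      rw [← h2, hm]
      push_cast
      abel
    have h2 : π (m y) = ⟨_, hw⟩ := by
      have h3 := (Submodule.projectionOnto_apply_eq_zero_iff hc).mpr hz
      rw [map_sub, Submodule.projectionOnto_apply_of_mem_left hc hw, sub_eq_zero] at h3
      exact h3
    have h4 : ω (V.symm u) (V.symm y) = -ω u y := by
      have := hV.1 (V.symm u) (V.symm y)
      rw [V.apply_symm_apply, V.apply_symm_apply] at this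
      rw [this, neg_neg]
    rw [LinearMap.comp_apply, sectionForm_apply, h1, h2, hm, h.apply_add hω, h4, arcForm_apply, hρ]
    congr 1
    rw [hu]
    push_cast
    simp only [map_sub, map_smul, LinearMap.sub_apply, LinearMap.smul_apply, smul_eq_mul]
    linear_combination (-(1 - ζ)⁻¹ * (ω (B y) (B y) - ζ * ω y (B y) - ω (B y) y + ζ * ω y y)) * I_sq

/-- Every finite-dimensional complex symplectic space has a symplectic splitting: a maximal
positive definite subspace of `-i ω` and its orthogonal. -/
theorem exists_splitting (hω : IsSkewHerm ω) (hnd : ∀ x, (∀ y, ω x y = 0) → x = 0) :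
    ∃ Hp Hm : Submodule ℂ H, IsSymplecticSplitting ω Hp Hm := by
  let h : H →ₗ[ℂ] H →ₗ⋆[ℂ] ℂ := (-I) • ω
  have hap : ∀ x y, h x y = -I * ω x y := fun _ _ => rfl
  have hh : IsHerm h := fun x y => by
    rw [hap, hap, hω x y, star_mul']
    simp
  obtain ⟨P, N, hc, hP, hN, hPN, -⟩ := hh.exists_decomp
  refine ⟨P, N, hc, fun x hx y hy => ?_, hP, fun x hx hx0 => ?_⟩
  · have := hPN y hy x hx
    rw [hap] at this
    exact hω.eq_zero_comm (by simpa using this)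
  · refine lt_of_le_of_ne (hN x hx) fun h0 => hx0 (hnd x fun y => ?_)
    obtain ⟨p, hp, q, hq, rfl⟩ := Submodule.mem_sup.mp
      (show y ∈ P ⊔ N from hc.sup_eq_top ▸ Submodule.mem_top)
    have h1 := hPN x hx p hp
    have h2 := hh.eq_zero_of_nonpos hN hx hq h0
    rw [hap] at h1 h2
    rw [map_add]
    have h3 : ω x p = 0 := by simpa using h1
    have h4 : ω x q = 0 := by simpa using h2
    rw [h3, h4, add_zero]

/-- With respect to a symplectic splitting, every Lagrangian subspace is a graph. -/
theorem exists_generates (h : IsSymplecticSplitting ω Hp Hm) (hω : IsSkewHerm ω)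
    (hL : ∀ x ∈ L, ∀ y ∈ L, ω x y = 0) (hd : finrank ℂ H = 2 * finrank ℂ L) :
    ∃ U : Hp ≃ₗ[ℂ] Hm, Generates ω U L := by
  have hdp : Disjoint L Hp := by
    rw [Submodule.disjoint_def]
    intro x hx hx'
    by_contra hx0
    have := h.pos x hx' hx0
    rw [hL x hx x hx] at this
    simp at this
  have hdm : Disjoint L Hm := by
    rw [Submodule.disjoint_def]
    intro x hx hx'
    by_contra hx0
    have := h.neg x hx' hx0
    rw [hL x hx x hx] at this
    simp at this
  have h1 := Submodule.finrank_sup_add_finrank_inf_eq L Hp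
  have h2 := Submodule.finrank_sup_add_finrank_inf_eq L Hm
  rw [hdp.eq_bot, finrank_bot] at h1
  rw [hdm.eq_bot, finrank_bot] at h2
  have h3 := Submodule.finrank_add_eq_of_isCompl h.isCompl
  have h4 := Submodule.finrank_le (L ⊔ Hp)
  have h5 := Submodule.finrank_le (L ⊔ Hm)
  obtain ⟨ℓ, hℓL, hℓ⟩ := exists_section h.isCompl hdm (by omega)
  have hmem : ∀ x, ℓ x ∈ L := fun x => by rw [← hℓL]; exact ⟨x, rfl⟩
  let u : Hp →ₗ[ℂ] Hm := LinearMap.codRestrict Hm (ℓ - Hp.subtype) hℓ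
  have hu : ∀ x, ℓ x = x + u x := fun x => by
    rw [show (u x : H) = ℓ x - x from rfl, add_sub_cancel]
  have hinj : Function.Injective u := by
    rw [injective_iff_map_eq_zero]
    intro x hx
    have h6 := hu x
    rw [hx, Submodule.coe_zero, add_zero] at h6
    exact Subtype.ext (Submodule.disjoint_def.mp hdp x (h6 ▸ hmem x) x.2)
  let U : Hp ≃ₗ[ℂ] Hm := LinearEquiv.ofInjectiveOfFinrankEq u hinj (by omega)
  have hU : ∀ x, U x = u x := fun _ => rfl
  refine ⟨U, fun x y => ?_, fun z => ?_⟩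
  · have h6 := hL _ (hmem x) _ (hmem y)
    rw [hu, hu, h.apply_add hω] at h6
    rw [hU, hU]
    linear_combination h6
  · rw [← hℓL]
    constructor
    · rintro ⟨x, rfl⟩
      exact ⟨x, hu x⟩
    · rintro ⟨x, rfl⟩
      exact ⟨x, hu x⟩

end Splitting

/-! ### The Maslov index of a path with respect to a fixed Lagrangian subspace -/

section PathIndex

open Module Complex Set

variable {H : Type*} [AddCommGroup H] [Module ℂ H] [FiniteDimensional ℂ H]
  {ω : H →ₗ[ℂ] H →ₗ⋆[ℂ] ℂ} {Hp Hm W F : Submodule ℂ H}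
  {E : Type*} [AddCommGroup E] [Module ℂ E] [FiniteDimensional ℂ E]
  {ι : Type*} [Fintype ι] [DecidableEq ι]

theorem exp_neg_mul_I_ne_one {θ : ℝ} (hθ : 0 < θ ∧ θ < Real.pi) : exp (-(θ * I)) ≠ 1 := by
  intro h
  rw [exp_eq_one_iff] at h
  obtain ⟨n, hn⟩ := h
  have h1 := congrArg im hn
  simp at h1
  have h2 : (-1 : ℝ) < n := by
    by_contra! h3
    nlinarith [Real.pi_pos]
  have h3 : (n : ℝ) < 0 := by
    by_contra! h3
    nlinarith [Real.pi_pos]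
  have h4 : (-1 : ℤ) < n := by exact_mod_cast h2
  have h5 : n < 0 := by exact_mod_cast h3
  omega

theorem norm_exp_neg_mul_I (θ : ℝ) : ‖exp (-(θ * I))‖ = 1 := by
  rw [← neg_mul, ← ofReal_neg, norm_exp_ofReal_mul_I]

/-- As long as `exp (-i θ)` is not an eigenvalue, the number of eigenvalues in the arc `-θ < φ < 0`
differs by a constant from an index that does not refer to the splitting: in
`posIndex_sectionForm` the index of `relForm` is constant, since its kernel has constant
dimension. -/
theorem exists_finrank_lowerArc_eq (hω : IsSkewHerm ω) (hnd : ∀ x, (∀ y, ω x y = 0) → x = 0)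
    (h : IsSymplecticSplitting ω Hp Hm) (hdim : finrank ℂ H = 2 * Fintype.card ι) {c d : ℝ}
    {j : ℝ → (ι → ℂ) →ₗ[ℂ] H} (hj : ∀ s, Function.Injective (j s))
    (hjc : ∀ (x : ι → ℂ) (f : H →ₗ[ℂ] ℂ), ContinuousOn (fun s => f (j s x)) (Icc c d))
    {U : ℝ → (Hp ≃ₗ[ℂ] Hm)} {V : Hp ≃ₗ[ℂ] Hm}
    (hU : ∀ s ∈ Icc c d, Generates ω (U s) (LinearMap.range (j s))) (hV : Generates ω V W)
    (hF : perp ω F = F) {r : ℕ} (hLF : ∀ s, finrank ℂ ↥(LinearMap.range (j s) ⊓ F) = r)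
    {q : ℝ → E →ₗ[ℂ] E →ₗ⋆[ℂ] ℂ} {S : ℝ → Submodule ℂ E} (p : H →ₗ[ℂ] E)
    (hS : ∀ s ∈ Icc c d, (LinearMap.range (j s) ⊓ (W ⊔ F)).map p = S s)
    (hq : ∀ s ∈ Icc c d, ∀ w ∈ W, ∀ f ∈ F, w + f ∈ LinearMap.range (j s) →
      (ω w f).re = (q s (p (w + f)) (p (w + f))).re)
    {θ : ℝ} (hθ : 0 < θ ∧ θ < Real.pi)
    (hspec : ∀ s ∈ Icc c d, exp (-(θ * I)) ∉
      spectrum ℂ ((U s).toLinearMap ∘ₗ V.symm.toLinearMap : Module.End ℂ Hm)) :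
    ∃ C : ℤ, ∀ s ∈ Icc c d,
      (finrank ℂ (spectralSubspace ((U s).toLinearMap ∘ₗ V.symm.toLinearMap : Module.End ℂ Hm)
        (lowerArc θ)) : ℤ)
      = posIndex (q s) (S s) - finrank ℂ ↥(LinearMap.range (j s) ⊓ W ⊓ F) + C := by
  rcases (Icc c d).eq_empty_or_nonempty with hcd | ⟨s₀, hs₀⟩
  · exact ⟨0, by simp [hcd]⟩
  set ζ := exp (-(θ * I)) with hζ
  have hζ1 : ζ ≠ 1 := exp_neg_mul_I_ne_one hθ
  have hW := hV.isotropic h hω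
  have hZ := rotGraph_isotropic h hω hV.1 (norm_exp_neg_mul_I θ)
  have hc := isCompl_rotGraph h hV hζ1
  have hFF : ∀ x ∈ F, ∀ y ∈ F, ω x y = 0 := fun x hx => by rwa [← hF] at hx
  rw [← hζ] at hZ
  have hHp : finrank ℂ Hp = Fintype.card ι := by
    have := finrank_eq_two_mul h V
    omega
  have hWd := hV.finrank_eq h
  have hdisj : ∀ s ∈ Icc c d, Disjoint (LinearMap.range (j s)) (rotGraph V ζ) := fun s hs =>
    disjoint_rotGraph h (hU s hs) (hspec s hs)
  have hsec : ∀ s : Icc c d, ∃ ℓ : W →ₗ[ℂ] H, LinearMap.range ℓ = LinearMap.range (j s) ∧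
      ∀ w, ℓ w - w ∈ rotGraph V ζ := fun s =>
    exists_section hc (hdisj s s.2) (by rw [(hU s s.2).finrank_eq h, hWd])
  choose ℓ hℓr hℓ using hsec
  have hL : ∀ (s : Icc c d) (w w' : W), ω (ℓ s w) (ℓ s w') = 0 := fun s w w' =>
    (hU s s.2).isotropic h hω _ (by rw [← hℓr]; exact ⟨w, rfl⟩) _
      (by rw [← hℓr]; exact ⟨w', rfl⟩)
  set π := W.projectionOnto (rotGraph V ζ) hc with hπ
  have hcont : ∀ (x : H) (w : W), Continuous fun s : Icc c d => ω x (ℓ s w) := by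
    have hG : ∀ (s : Icc c d) (w : W), ∃ v, j s v = ℓ s w := fun s w => by
      have : ℓ s w ∈ LinearMap.range (j s) := by rw [← hℓr]; exact ⟨w, rfl⟩
      exact this
    choose G hG using hG
    have hjc' : ∀ (x : ι → ℂ) (f : H →ₗ[ℂ] ℂ), Continuous fun s : Icc c d => f (j s x) :=
      fun x f => continuousOn_iff_continuous_domRestrict.mp (hjc x f)
    have hGc : ∀ w, Continuous fun s => G s w := by
      intro w
      apply continuous_of_section (P := fun s : Icc c d => π ∘ₗ j s) (by omega)
      · intro x f
        exact hjc' x (f ∘ₗ π)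
      · intro s y
        rw [LinearMap.comp_apply, hG]
        exact projectionOnto_section hc (hℓ s) y
      · intro s
        rw [injective_iff_map_eq_zero]
        intro x hx
        have h1 : j s x ∈ rotGraph V ζ := (Submodule.projectionOnto_apply_eq_zero_iff hc).mp hx
        have h2 := Submodule.disjoint_def.mp (hdisj s s.2) _ ⟨x, rfl⟩ h1
        exact hj s (by rw [h2, map_zero])
    intro x w
    have h1 : ∀ s : Icc c d, ω x (ℓ s w) = -star (∑ i, G s w i * ω (j s (Pi.single i 1)) x) := by
      intro s
      rw [hω, ← hG]
      congr 2
      conv_lhs => rw [← Finset.univ_sum_single (G s w)]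
      rw [map_sum, map_sum, LinearMap.sum_apply]
      refine Finset.sum_congr rfl fun i _ => ?_
      have h2 : Pi.single i (G s w i) = G s w i • (Pi.single i 1 : ι → ℂ) := by
        ext k
        simp [Pi.single_apply]
      rw [h2, map_smul, map_smul, LinearMap.smul_apply, smul_eq_mul]
    simp_rw [h1]
    refine (continuous_star.comp (continuous_finsetSum _ fun i _ => ?_)).neg
    exact ((continuous_apply i).comp (hGc w)).mul (hjc' _ (ω.flip x))
  have hconst : ∀ s t : Icc c d,
      posIndex (relForm ω F π (ℓ s)) ⊤ = posIndex (relForm ω F π (ℓ t)) ⊤ := by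
    have : PreconnectedSpace (Icc c d) := Subtype.preconnectedSpace isPreconnected_Icc
    apply posIndex_eq_of_finrank_ker_eq
    · exact fun s => isHerm_relForm hω hc hW hZ hFF (hℓ s) (hL s)
    · intro x y
      simp only [relForm_apply]
      exact (hcont _ _).sub continuous_const
    · intro s t
      rw [finrank_ker_relForm hω hc hW hZ hF (hℓ s) (hL s),
        finrank_ker_relForm hω hc hW hZ hF (hℓ t) (hL t), hℓr, hℓr, hLF, hLF]
  refine ⟨posIndex (relForm ω F π (ℓ ⟨s₀, hs₀⟩)) ⊤ + r - posIndex (-projForm ω F π) ⊤, ?_⟩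
  intro s hs
  have h1 := posIndex_sectionForm hω
    (fun x hx => hnd x fun y => hω.eq_zero_comm (hx y)) hc hW hZ hF (hℓ ⟨s, hs⟩) (hL ⟨s, hs⟩)
    (q := q s) (S := S s) p (by rw [hℓr]; exact hS s hs) (by rw [hℓr]; exact hq s hs)
  rw [hℓr, hLF, ← finrank_spectralSubspace_eq_posIndex h hω (hU s hs) hV hθ hc (hℓr _)
    (hℓ ⟨s, hs⟩) hζ1, ← hπ, hconst ⟨s, hs⟩ ⟨s₀, hs₀⟩] at h1
  dsimp only at h1
  omega

/-- A continuous path of unitary maps admits a partition as in the definition of the spectral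
flow, by the Lebesgue number lemma. -/
theorem exists_hasSpectralFlow (h : IsSymplecticSplitting ω Hp Hm)
    (hdim : finrank ℂ H = 2 * Fintype.card ι) {a b : ℝ} (hab : a < b)
    {j : ℝ → (ι → ℂ) →ₗ[ℂ] H} (hj : ∀ s, Function.Injective (j s))
    (hjc : ∀ (x : ι → ℂ) (f : H →ₗ[ℂ] ℂ), ContinuousOn (fun s => f (j s x)) (Icc a b))
    {U V : ℝ → (Hp ≃ₗ[ℂ] Hm)} {V₀ : Hp ≃ₗ[ℂ] Hm}
    (hU : ∀ s ∈ Icc a b, Generates ω (U s) (LinearMap.range (j s)))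
    (hV : ∀ s ∈ Icc a b, V s = V₀) :
    ∃ k, HasSpectralFlow a b
      (fun s => (U s).toLinearMap ∘ₗ (V s).symm.toLinearMap : ℝ → Module.End ℂ Hm) k := by
  let A : ℝ → Module.End ℂ Hm := fun s => (U s).toLinearMap ∘ₗ (V s).symm.toLinearMap
  let πp := Hp.projectionOnto Hm h.isCompl
  let πm := Hm.projectionOnto Hp h.isCompl.symm
  have hHm : finrank ℂ Hm = Fintype.card ι := by
    have h1 := finrank_eq_two_mul h V₀
    have h2 := V₀.finrank_eq
    omega
  -- `ζ` is not an eigenvalue iff the map `x ↦ πm (j x) - ζ V (πp (j x))` is injective.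
  have hiff : ∀ (ζ : ℂ) (s : Icc a b), ζ ∉ spectrum ℂ (A s) ↔
      Function.Injective (πm ∘ₗ j s - ζ • (V₀.toLinearMap ∘ₗ πp ∘ₗ j s)) := by
    intro ζ s
    rw [notMem_spectrum_iff, hV s s.2, injective_iff_map_eq_zero]
    have hg := hU s s.2
    have hjU : ∀ v, j s v = πp (j s v) + U s (πp (j s v)) ∧ πm (j s v) = U s (πp (j s v)) := by
      intro v
      obtain ⟨x, hx⟩ := (hg.2 (j s v)).mp ⟨v, rfl⟩
      have h1 : πp (j s v) = x := by
        rw [hx, map_add, Submodule.projectionOnto_apply_left, Submodule.projectionOnto_apply_right,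
          add_zero]
      have h2 : πm (j s v) = U s x := by
        rw [hx, map_add, Submodule.projectionOnto_apply_left, Submodule.projectionOnto_apply_right,
          zero_add]
      rw [h1, h2]
      exact ⟨hx, rfl⟩
    constructor
    · intro h0 v hv
      have h1 : πm (j s v) = ζ • V₀ (πp (j s v)) := sub_eq_zero.mp hv
      rw [(hjU v).2] at h1
      apply hj s
      rw [(hjU v).1, h0 _ h1]
      simp
    · intro h0 x hx
      obtain ⟨v, hv⟩ : (x + U s x : H) ∈ LinearMap.range (j s) := hg.mem x
      have h1 : πp (j s v) = x := by
        rw [hv, map_add, Submodule.projectionOnto_apply_left, Submodule.projectionOnto_apply_right,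
          add_zero]
      have h2 := h0 v (by
        change πm (j s v) - ζ • V₀ (πp (j s v)) = 0
        rw [(hjU v).2, h1, hx, sub_self])
      rw [← h1, h2, map_zero, map_zero]
  let c : ℝ → Set (Icc a b) := fun θ => {s | 0 < θ ∧ θ < Real.pi ∧
    exp (θ * I) ∉ spectrum ℂ (A s) ∧ exp (-(θ * I)) ∉ spectrum ℂ (A s)}
  have hopen1 : ∀ ζ : ℂ, IsOpen {s : Icc a b | ζ ∉ spectrum ℂ (A s)} := by
    intro ζ
    simp_rw [hiff]
    apply isOpen_setOf_injective hHm
    intro x f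
    have hjc' : ∀ f : H →ₗ[ℂ] ℂ, Continuous fun s : Icc a b => f (j s x) :=
      fun f => continuousOn_iff_continuous_domRestrict.mp (hjc x f)
    exact hjc' (f ∘ₗ (πm - ζ • (V₀.toLinearMap ∘ₗ πp)))
  have hopen : ∀ θ, IsOpen (c θ) := by
    intro θ
    exact isOpen_const.and (isOpen_const.and ((hopen1 _).inter (hopen1 _)))
  have hcover : (univ : Set (Icc a b)) ⊆ ⋃ θ, c θ := by
    intro s _
    -- Only finitely many angles are excluded.
    have hfin : {θ : ℝ | θ ∈ Ioo 0 Real.pi ∧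
        (exp (θ * I) ∈ spectrum ℂ (A s) ∨ exp (-(θ * I)) ∈ spectrum ℂ (A s))}.Finite := by
      have h1 : (spectrum ℂ (A s)).Finite := Module.End.finite_spectrum (A s)
      have harg : ∀ θ ∈ Ioo 0 Real.pi, (exp (θ * I)).arg = θ := fun θ hθ => by
        rw [arg_exp_mul_I, toIocMod_eq_self]
        exact ⟨by linarith [hθ.1, Real.pi_pos], by linarith [hθ.2]⟩
      have harg' : ∀ θ ∈ Ioo 0 Real.pi, -(exp (-(θ * I))).arg = θ := fun θ hθ => by
        rw [← neg_mul, ← ofReal_neg, arg_exp_mul_I, (toIocMod_eq_self _).mpr, neg_neg]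
        exact ⟨by linarith [hθ.2], by linarith [hθ.1, Real.pi_pos]⟩
      refine ((h1.image arg).union (h1.image fun z => -arg z)).subset ?_
      rintro θ ⟨hθ, h2 | h2⟩
      · exact Or.inl ⟨_, h2, harg θ hθ⟩
      · exact Or.inr ⟨_, h2, harg' θ hθ⟩
    obtain ⟨θ, hθ, hθ'⟩ := (Ioo_infinite Real.pi_pos).exists_notMem_finite hfin
    rw [mem_iUnion]
    simp only [mem_ofPred_eq, not_and, not_or] at hθ'
    exact ⟨θ, hθ.1, hθ.2, hθ' hθ⟩
  obtain ⟨δ, hδ, hball⟩ := lebesgue_number_lemma_of_metric isCompact_univ hopen hcover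
  obtain ⟨m, hm⟩ := exists_nat_gt ((b - a) / δ)
  have hm0 : (0 : ℝ) < m := (div_pos (sub_pos.mpr hab) hδ).trans hm
  have hstep : (b - a) / m < δ := by
    rw [div_lt_iff₀ hδ] at hm
    rw [div_lt_iff₀ hm0]
    linarith
  have hstep0 : 0 < (b - a) / m := div_pos (sub_pos.mpr hab) hm0
  let s : ℕ → ℝ := fun i => a + i * ((b - a) / m)
  have hs : ∀ i, s (i + 1) = s i + (b - a) / m := fun i => by
    simp only [s]
    push_cast
    ring
  have hsm : s m = b := by
    simp only [s]
    field_simp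
    ring
  have hmem : ∀ i ≤ m, s i ∈ Icc a b := fun i hi => by
    refine ⟨?_, ?_⟩
    · have : (0 : ℝ) ≤ i * ((b - a) / m) := by positivity
      simp only [s]
      linarith
    · rw [← hsm]
      have : (i : ℝ) ≤ m := by exact_mod_cast hi
      simp only [s]
      gcongr
  have hθ : ∀ i, ∃ θ : ℝ, i < m → 0 < θ ∧ θ < Real.pi ∧ ∀ u ∈ Icc (s i) (s (i + 1)),
      exp (θ * I) ∉ spectrum ℂ (A u) ∧ exp (-(θ * I)) ∉ spectrum ℂ (A u) := by
    intro i
    by_cases hi : i < m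
    · obtain ⟨θ, hθ⟩ := hball ⟨s i, hmem i hi.le⟩ (mem_univ _)
      have h0 := hθ (Metric.mem_ball_self hδ)
      refine ⟨θ, fun _ => ⟨h0.1, h0.2.1, fun u hu => ?_⟩⟩
      have hu' : u ∈ Icc a b := ⟨(hmem i hi.le).1.trans hu.1, hu.2.trans (hmem (i + 1) hi).2⟩
      have h1 : (⟨u, hu'⟩ : Icc a b) ∈ Metric.ball (⟨s i, hmem i hi.le⟩ : Icc a b) δ := by
        rw [Metric.mem_ball, Subtype.dist_eq, Real.dist_eq, abs_of_nonneg (sub_nonneg.mpr hu.1)]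
        have := hu.2
        rw [hs] at this
        linarith
      exact (hθ h1).2.2
    · exact ⟨0, fun h => absurd h hi⟩
  choose θ hθ using hθ
  exact ⟨_, m, s, θ, by simp [s], hsm, fun i _ => by rw [hs]; linarith,
    fun i hi => ⟨(hθ i hi).1, (hθ i hi).2.1⟩, fun i hi => (hθ i hi).2.2, rfl⟩

/-- The Maslov index of a continuous path of Lagrangian subspaces `range (j s)` with respect to a
fixed Lagrangian subspace `W`, computed by means of an auxiliary Lagrangian subspace `F` that the
path meets in constant dimension. -/
theorem hasMaslovIndex_iff (hω : IsSkewHerm ω) (hnd : ∀ x, (∀ y, ω x y = 0) → x = 0)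
    (hdim : finrank ℂ H = 2 * Fintype.card ι) {a b : ℝ} (hab : a < b)
    {j : ℝ → (ι → ℂ) →ₗ[ℂ] H} (hj : ∀ s, Function.Injective (j s))
    (hjc : ∀ (x : ι → ℂ) (f : H →ₗ[ℂ] ℂ), ContinuousOn (fun s => f (j s x)) (Icc a b))
    (hjL : ∀ s ∈ Icc a b, ∀ x y, ω (j s x) (j s y) = 0)
    (hW : ∀ x ∈ W, ∀ y ∈ W, ω x y = 0) (hWd : finrank ℂ W = Fintype.card ι)
    (hF : perp ω F = F) {r : ℕ} (hLF : ∀ s, finrank ℂ ↥(LinearMap.range (j s) ⊓ F) = r)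
    {q : ℝ → E →ₗ[ℂ] E →ₗ⋆[ℂ] ℂ} {S : ℝ → Submodule ℂ E} (p : H →ₗ[ℂ] E)
    (hS : ∀ s ∈ Icc a b, (LinearMap.range (j s) ⊓ (W ⊔ F)).map p = S s)
    (hq : ∀ s ∈ Icc a b, ∀ w ∈ W, ∀ f ∈ F, w + f ∈ LinearMap.range (j s) →
      (ω w f).re = (q s (p (w + f)) (p (w + f))).re) (k : ℤ) :
    HasMaslovIndex ω a b (fun s => LinearMap.range (j s)) (fun _ => W) k ↔
      k = (posIndex (q b) (S b) - finrank ℂ ↥(LinearMap.range (j b) ⊓ W ⊓ F))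
        - (posIndex (q a) (S a) - finrank ℂ ↥(LinearMap.range (j a) ⊓ W ⊓ F)) := by
  set N : ℝ → ℤ := fun s => posIndex (q s) (S s) - finrank ℂ ↥(LinearMap.range (j s) ⊓ W ⊓ F)
    with hN
  have hforward : ∀ k, HasMaslovIndex ω a b (fun s => LinearMap.range (j s)) (fun _ => W) k →
      k = N b - N a := by
    rintro k ⟨Hp, Hm, U, V, h, hUV, m, s, θ, hs0, hsm, hs, hθ, hspec, hk⟩
    have hVa : ∀ u ∈ Icc a b, V u = V a := fun u hu =>
      (hUV u hu).2.unique h (hUV a (left_mem_Icc.mpr hab.le)).2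
    have hmono : ∀ i i', i ≤ i' → i' ≤ m → s i ≤ s i' := by
      intro i i' hi
      induction i', hi using Nat.le_induction with
      | base => exact fun _ => le_rfl
      | succ i' _ ih => exact fun hi' => (ih (by omega)).trans (hs i' (by omega)).le
    have hsub : ∀ i < m, Icc (s i) (s (i + 1)) ⊆ Icc a b := fun i hi =>
      Icc_subset_Icc (hs0 ▸ hmono 0 i (Nat.zero_le _) hi.le) (hsm ▸ hmono (i + 1) m hi le_rfl)
    have hterm : ∀ i ∈ Finset.range m,
        ((finrank ℂ (spectralSubspace ((U (s i)).toLinearMap ∘ₗ (V (s i)).symm.toLinearMap :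
          Module.End ℂ Hm) (lowerArc (θ i))) : ℤ)
        - (finrank ℂ (spectralSubspace ((U (s (i + 1))).toLinearMap ∘ₗ
          (V (s (i + 1))).symm.toLinearMap : Module.End ℂ Hm) (lowerArc (θ i))) : ℤ))
        = N (s i) - N (s (i + 1)) := by
      intro i hi
      rw [Finset.mem_range] at hi
      have hl : s i ∈ Icc (s i) (s (i + 1)) := left_mem_Icc.mpr (hs i hi).le
      have hr : s (i + 1) ∈ Icc (s i) (s (i + 1)) := right_mem_Icc.mpr (hs i hi).le
      obtain ⟨C, hC⟩ := exists_finrank_lowerArc_eq hω hnd h hdim hj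
        (fun x f => (hjc x f).mono (hsub i hi))
        (fun u hu => (hUV u (hsub i hi hu)).1) (hUV a (left_mem_Icc.mpr hab.le)).2 hF hLF p
        (fun u hu => hS u (hsub i hi hu)) (fun u hu => hq u (hsub i hi hu)) (hθ i hi)
        (fun u hu => by
          have := (hspec i hi u hu).2
          dsimp only at this
          rwa [hVa u (hsub i hi hu)] at this)
      rw [hVa _ (hsub i hi hl), hVa _ (hsub i hi hr), hC _ hl, hC _ hr]
      simp only [hN]
      ring
    rw [Finset.sum_congr rfl hterm, Finset.sum_range_sub', hs0, hsm] at hk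
    linarith
  -- Conversely some integer is a Maslov index, and it has to be the given one.
  refine ⟨hforward k, ?_⟩
  rintro rfl
  obtain ⟨Hp, Hm, h⟩ := exists_splitting hω hnd
  obtain ⟨V, hV⟩ := exists_generates h hω hW (by omega)
  have hex : ∀ s, ∃ U : Hp ≃ₗ[ℂ] Hm, s ∈ Icc a b → Generates ω U (LinearMap.range (j s)) := by
    intro s
    by_cases hs : s ∈ Icc a b
    · have hd : finrank ℂ (LinearMap.range (j s)) = Fintype.card ι := by
        rw [LinearMap.finrank_range_of_inj (hj s), finrank_fintype_fun_eq_card]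
      obtain ⟨U, hU⟩ := exists_generates (L := LinearMap.range (j s)) h hω (by
        rintro _ ⟨x, rfl⟩ _ ⟨y, rfl⟩
        exact hjL s hs x y) (by omega)
      exact ⟨U, fun _ => hU⟩
    · exact ⟨V, fun h => absurd h hs⟩
  choose U hU using hex
  obtain ⟨k, hk⟩ := exists_hasSpectralFlow h hdim hab hj hjc (V := fun _ => V) (V₀ := V) hU
    (fun _ _ => rfl)
  have hmas : HasMaslovIndex ω a b (fun s => LinearMap.range (j s)) (fun _ => W) (-k) :=
    ⟨Hp, Hm, U, fun _ => V, h, fun s hs => ⟨hU s hs, hV⟩, by rwa [neg_neg]⟩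
  have := hforward _ hmas
  rwa [this] at hmas

end PathIndex

/-! ### The symplectic space of the boundary conditions -/

section BoundaryConditions

open Module Matrix

section FormLemmas

variable {ι : Type*} [Fintype ι]

theorem form_apply (A : Matrix ι ι ℂ) (x y : ι → ℂ) : form A x y = (A *ᵥ x) ⬝ᵥ star y := rfl

theorem form_mulVec_left (A B : Matrix ι ι ℂ) (x y : ι → ℂ) :
    form A (B *ᵥ x) y = form (A * B) x y := by
  rw [form_apply, form_apply, mulVec_mulVec]

theorem form_mulVec_right (A B : Matrix ι ι ℂ) (x y : ι → ℂ) :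
    form A x (B *ᵥ y) = form (Bᴴ * A) x y := by
  rw [form_apply, form_apply, star_mulVec, ← mulVec_mulVec, dotProduct_comm, ← dotProduct_mulVec,
    dotProduct_comm]

theorem star_form (A : Matrix ι ι ℂ) (x y : ι → ℂ) : star (form A x y) = form Aᴴ y x := by
  rw [form_apply, form_apply, ← star_dotProduct_star, star_star, star_mulVec, dotProduct_comm,
    ← dotProduct_mulVec, dotProduct_comm]

open scoped ComplexOrder in
theorem eq_zero_of_form_left [DecidableEq ι] {A : Matrix ι ι ℂ} (hA : IsUnit A) {x : ι → ℂ}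
    (h : ∀ y, form A x y = 0) : x = 0 := by
  have h1 : A *ᵥ x = 0 := by
    have := h (A *ᵥ x)
    rwa [form_apply, dotProduct_self_star_eq_zero] at this
  exact (mulVec_injective_iff_isUnit.mpr hA) (by rw [h1, mulVec_zero])

theorem eq_zero_of_form_right [DecidableEq ι] {A : Matrix ι ι ℂ} (hA : IsUnit A) {y : ι → ℂ}
    (h : ∀ x, form A x y = 0) : y = 0 := by
  apply eq_zero_of_form_left (A := Aᴴ) hA.star
  intro x
  rw [← star_form, h, star_zero]

end FormLemmas

/-- For a non-degenerate form the right orthogonal of the left orthogonal of `D` is `D`. -/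
theorem mem_of_perp {V : Type*} [AddCommGroup V] [Module ℂ V] [FiniteDimensional ℂ V]
    {h : V →ₗ[ℂ] V →ₗ⋆[ℂ] ℂ} (hnd : ∀ y, (∀ x, h x y = 0) → y = 0) {D : Submodule ℂ V} {d : V}
    (hd : ∀ u ∈ perp h D, h u d = 0) : d ∈ D := by
  have h1 : perp h (D ⊔ ℂ ∙ d) = perp h D := by
    apply le_antisymm
    · exact fun u hu x hx => hu x (Submodule.mem_sup_left hx)
    · intro u hu x hx
      obtain ⟨a, ha, b, hb, rfl⟩ := Submodule.mem_sup.mp hx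
      obtain ⟨c, rfl⟩ := Submodule.mem_span_singleton.mp hb
      rw [map_add, hu a ha, map_smulₛₗ, hd u hu, smul_zero, add_zero]
  have h2 := finrank_perp_of_disjoint (h := h) (C := D) fun c _ => hnd c
  have h3 := finrank_perp_of_disjoint (h := h) (C := D ⊔ ℂ ∙ d) fun c _ => hnd c
  rw [h1] at h3
  have h4 : D = D ⊔ ℂ ∙ d := Submodule.eq_of_le_of_finrank_eq le_sup_left (by omega)
  rw [h4]
  exact Submodule.mem_sup_right (Submodule.mem_span_singleton_self d)

variable {n : ℕ}

/-- The form `⟨K x₁, y₁⟩ - ⟨K x₂, y₂⟩` on `ℂⁿ ⊕ ℂⁿ`, for which `R^K` is the orthogonal of `R`. -/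
def pairForm (K : Matrix (Fin n) (Fin n) ℂ) :
    ((Fin n → ℂ) × (Fin n → ℂ)) →ₗ[ℂ] ((Fin n → ℂ) × (Fin n → ℂ)) →ₗ⋆[ℂ] ℂ :=
  pullback (form K) (LinearMap.fst ℂ _ _) - pullback (form K) (LinearMap.snd ℂ _ _)

theorem pairForm_apply (K : Matrix (Fin n) (Fin n) ℂ) (x y : (Fin n → ℂ) × (Fin n → ℂ)) :
    pairForm K x y = form K x.1 y.1 - form K x.2 y.2 := rfl

variable (n) in
/-- The projection `(x₁, x₂, x₃, x₄) ↦ (x₁, x₃)`. -/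
def oddPart : ((Fin n ⊕ Fin n → ℂ) × (Fin n ⊕ Fin n → ℂ)) →ₗ[ℂ] (Fin n → ℂ) × (Fin n → ℂ) :=
  (LinearMap.funLeft ℂ ℂ Sum.inl).prodMap (LinearMap.funLeft ℂ ℂ Sum.inl)

variable (n) in
/-- The projection `(x₁, x₂, x₃, x₄) ↦ (x₂, x₄)`. -/
def evenPart : ((Fin n ⊕ Fin n → ℂ) × (Fin n ⊕ Fin n → ℂ)) →ₗ[ℂ] (Fin n → ℂ) × (Fin n → ℂ) :=
  (LinearMap.funLeft ℂ ℂ Sum.inr).prodMap (LinearMap.funLeft ℂ ℂ Sum.inr)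

theorem oddPart_apply (z : (Fin n ⊕ Fin n → ℂ) × (Fin n ⊕ Fin n → ℂ)) :
    oddPart n z = (z.1 ∘ Sum.inl, z.2 ∘ Sum.inl) := rfl

theorem evenPart_apply (z : (Fin n ⊕ Fin n → ℂ) × (Fin n ⊕ Fin n → ℂ)) :
    evenPart n z = (z.1 ∘ Sum.inr, z.2 ∘ Sum.inr) := rfl

theorem exists_parts (u v : (Fin n → ℂ) × (Fin n → ℂ)) :
    ∃ z, oddPart n z = u ∧ evenPart n z = v :=
  ⟨(Sum.elim u.1 v.1, Sum.elim u.2 v.2), rfl, rfl⟩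

theorem ext_parts {z w : (Fin n ⊕ Fin n → ℂ) × (Fin n ⊕ Fin n → ℂ)}
    (h1 : oddPart n z = oddPart n w) (h2 : evenPart n z = evenPart n w) : z = w := by
  rw [oddPart_apply, oddPart_apply, Prod.mk.injEq] at h1
  rw [evenPart_apply, evenPart_apply, Prod.mk.injEq] at h2
  ext i
  · rcases i with i | i
    exacts [congrFun h1.1 i, congrFun h2.1 i]
  · rcases i with i | i
    exacts [congrFun h1.2 i, congrFun h2.2 i]

variable {K : Matrix (Fin n) (Fin n) ℂ} {R : Submodule ℂ ((Fin n → ℂ) × (Fin n → ℂ))}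

theorem RK_eq_perp : RK K R = perp (pairForm K) R := rfl

theorem mem_WK_iff {z : (Fin n ⊕ Fin n → ℂ) × (Fin n ⊕ Fin n → ℂ)} :
    z ∈ WK K R ↔ oddPart n z ∈ RK K R ∧ evenPart n z ∈ R := Iff.rfl

theorem form_JK (x y : Fin n ⊕ Fin n → ℂ) :
    form (JK K) x y
      = form K (x ∘ Sum.inl) (y ∘ Sum.inr) - star (form K (y ∘ Sum.inl) (x ∘ Sum.inr)) := by
  rw [star_form, form_apply, JK, fromBlocks_mulVec, form_apply, form_apply]
  simp only [dotProduct, Fintype.sum_sum_type, Sum.elim_inl, Sum.elim_inr, zero_mulVec, zero_add,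
    add_zero, neg_mulVec, Pi.neg_apply, Pi.star_apply, Function.comp_apply, neg_mul,
    Finset.sum_neg_distrib]
  ring

/-- The odd and the even coordinates form a pair of Lagrangian subspaces, paired by `pairForm`. -/
theorem graphForm_JK (z w : (Fin n ⊕ Fin n → ℂ) × (Fin n ⊕ Fin n → ℂ)) :
    graphForm (JK K) z w
      = star (pairForm K (oddPart n w) (evenPart n z)) - pairForm K (oddPart n z) (evenPart n w) := by
  change -form (JK K) z.1 w.1 + form (JK K) z.2 w.2 = _
  rw [form_JK, form_JK, pairForm_apply, pairForm_apply, star_sub]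
  simp only [oddPart_apply, evenPart_apply]
  ring

theorem pairForm_left (hK : IsUnit K) {x : (Fin n → ℂ) × (Fin n → ℂ)}
    (h : ∀ y, pairForm K x y = 0) : x = 0 := by
  have h1 : x.1 = 0 := eq_zero_of_form_left hK fun y => by
    simpa [pairForm_apply] using h (y, 0)
  have h2 : x.2 = 0 := eq_zero_of_form_left hK fun y => by
    simpa [pairForm_apply] using h (0, y)
  exact Prod.ext h1 h2

theorem pairForm_right (hK : IsUnit K) {y : (Fin n → ℂ) × (Fin n → ℂ)}
    (h : ∀ x, pairForm K x y = 0) : y = 0 := by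
  have h1 : y.1 = 0 := eq_zero_of_form_right hK fun x => by
    simpa [pairForm_apply] using h (x, 0)
  have h2 : y.2 = 0 := eq_zero_of_form_right hK fun x => by
    simpa [pairForm_apply] using h (0, x)
  exact Prod.ext h1 h2

theorem isSkewHerm_graphForm : IsSkewHerm (graphForm (JK K)) := fun z w => by
  rw [graphForm_JK, graphForm_JK, star_sub, star_star]
  ring

theorem graphForm_nondegenerate (hK : IsUnit K)
    (z : (Fin n ⊕ Fin n → ℂ) × (Fin n ⊕ Fin n → ℂ)) (h : ∀ w, graphForm (JK K) z w = 0) :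
    z = 0 := by
  apply ext_parts
  · rw [map_zero]
    apply pairForm_left hK
    intro y
    obtain ⟨w, h1, h2⟩ := exists_parts 0 y
    have h3 := h w
    rw [graphForm_JK, h1, h2] at h3
    simpa using h3
  · rw [map_zero]
    apply pairForm_right hK
    intro x
    obtain ⟨w, h1, h2⟩ := exists_parts x 0
    have h3 := h w
    rw [graphForm_JK, h1, h2] at h3
    simpa using h3

/-- The vectors with vanishing odd coordinates form a Lagrangian subspace. -/
theorem perp_ker_oddPart (hK : IsUnit K) :
    perp (graphForm (JK K)) (LinearMap.ker (oddPart n)) = LinearMap.ker (oddPart n) := by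
  apply le_antisymm
  · intro z hz
    apply pairForm_left hK
    intro y
    obtain ⟨w, h1, h2⟩ := exists_parts 0 y
    have h3 := hz w h1
    rw [graphForm_JK, h1, h2] at h3
    simpa using h3
  · intro z hz w hw
    rw [graphForm_JK, LinearMap.mem_ker.mp hz, LinearMap.mem_ker.mp hw]
    simp

theorem WK_isotropic : ∀ z ∈ WK K R, ∀ w ∈ WK K R, graphForm (JK K) z w = 0 := by
  intro z hz w hw
  rw [graphForm_JK, show pairForm K (oddPart n w) (evenPart n z) = 0 from hw.1 _ hz.2,
    show pairForm K (oddPart n z) (evenPart n w) = 0 from hz.1 _ hw.2]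
  simp

theorem finrank_RK_add (hK : IsUnit K) (R : Submodule ℂ ((Fin n → ℂ) × (Fin n → ℂ))) :
    finrank ℂ (RK K R) + finrank ℂ R = 2 * n := by
  have h1 := finrank_perp_of_disjoint (h := pairForm K) (C := R) fun c _ => pairForm_right hK
  rw [finrank_prod, finrank_fin_fun] at h1
  rw [RK_eq_perp]
  omega

theorem disjoint_ker_parts {D : Submodule ℂ ((Fin n ⊕ Fin n → ℂ) × (Fin n ⊕ Fin n → ℂ))}
    (hD : D ≤ LinearMap.ker (oddPart n)) : Disjoint D (LinearMap.ker (evenPart n)) := by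
  rw [Submodule.disjoint_def]
  intro z hz hz'
  apply ext_parts
  · rw [LinearMap.mem_ker.mp (hD hz), map_zero]
  · rw [LinearMap.mem_ker.mp hz', map_zero]

theorem finrank_WK (hK : IsUnit K) : finrank ℂ (WK K R) = 2 * n := by
  have h1 := finrank_map_add_finrank_inf_ker (oddPart n) (WK K R)
  have h2 : (WK K R).map (oddPart n) = RK K R := by
    ext x
    constructor
    · rintro ⟨z, hz, rfl⟩
      exact hz.1
    · intro hx
      obtain ⟨z, hz1, hz2⟩ := exists_parts x 0
      refine ⟨z, mem_WK_iff.mpr ⟨hz1 ▸ hx, hz2 ▸ R.zero_mem⟩, hz1⟩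
  have h3 : (WK K R ⊓ LinearMap.ker (oddPart n)).map (evenPart n) = R := by
    ext x
    constructor
    · rintro ⟨z, hz, rfl⟩
      exact hz.1.2
    · intro hx
      obtain ⟨z, hz1, hz2⟩ := exists_parts 0 x
      refine ⟨z, ⟨mem_WK_iff.mpr ⟨hz1 ▸ Submodule.zero_mem _, hz2 ▸ hx⟩, hz1⟩, hz2⟩
  rw [h2, ← finrank_map_of_disjoint_ker (evenPart n) (disjoint_ker_parts inf_le_right), h3,
    finrank_RK_add hK] at h1
  exact h1.symm

/-- The graphs of `M₁` and `M₂` are orthogonal for `pairForm K` if `M₂ᴴ K M₁ = K`, which compares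
the intersection of one with `R` and of the other with `R^K`. -/
theorem perp_Gr (hK : IsUnit K) {M₁ M₂ : Matrix (Fin n) (Fin n) ℂ} (hM : M₂ᴴ * K * M₁ = K) :
    perp (pairForm K) (Gr M₂) = Gr M₁ := by
  have hfr : ∀ M : Matrix (Fin n) (Fin n) ℂ, finrank ℂ (Gr M) = n := fun M => by
    rw [Gr, LinearMap.graph_eq_range_prod, LinearMap.finrank_range_of_inj, finrank_fin_fun]
    exact fun x y hxy => congrArg Prod.fst hxy
  symm
  apply Submodule.eq_of_le_of_finrank_eq
  · intro x hx y hy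
    rw [Gr, LinearMap.mem_graph_iff, mulVecLin_apply] at hx hy
    rw [pairForm_apply, hx, hy, form_mulVec_left, form_mulVec_right, ← mul_assoc, hM, sub_self]
  · have h1 := finrank_perp_of_disjoint (h := pairForm K) (C := Gr M₂)
      fun c _ => pairForm_right hK
    rw [finrank_prod, finrank_fin_fun, hfr] at h1
    rw [hfr]
    omega

theorem perp_sup_Gr (hK : IsUnit K) {M₁ M₂ : Matrix (Fin n) (Fin n) ℂ} (hM : M₂ᴴ * K * M₁ = K) :
    perp (pairForm K) (R ⊔ Gr M₂) = RK K R ⊓ Gr M₁ := by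
  rw [← perp_Gr hK hM, RK_eq_perp]
  ext x
  constructor
  · intro hx
    exact ⟨fun d hd => hx d (Submodule.mem_sup_left hd),
      fun d hd => hx d (Submodule.mem_sup_right hd)⟩
  · rintro ⟨hx, hx'⟩ y hy
    obtain ⟨p, hp, q, hq, rfl⟩ := Submodule.mem_sup.mp hy
    rw [map_add, hx p hp, hx' q hq, add_zero]

theorem finrank_Gr_inf (hK : IsUnit K) {M₁ M₂ : Matrix (Fin n) (Fin n) ℂ}
    (hM : M₂ᴴ * K * M₁ = K) :
    finrank ℂ ↥(Gr M₂ ⊓ R) + finrank ℂ (RK K R) = n + finrank ℂ ↥(Gr M₁ ⊓ RK K R) := by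
  have hfr : finrank ℂ (Gr M₂) = n := by
    rw [Gr, LinearMap.graph_eq_range_prod, LinearMap.finrank_range_of_inj, finrank_fin_fun]
    exact fun x y hxy => congrArg Prod.fst hxy
  have h1 := finrank_perp_of_disjoint (h := pairForm K) (C := R ⊔ Gr M₂)
    fun c _ => pairForm_right hK
  rw [perp_sup_Gr hK hM, finrank_prod, finrank_fin_fun] at h1
  have h2 := Submodule.finrank_sup_add_finrank_inf_eq R (Gr M₂)
  have h3 := finrank_RK_add hK R
  rw [inf_comm (Gr M₂), inf_comm (Gr M₁)]
  omega

theorem finrank_SK (M : Matrix (Fin n) (Fin n) ℂ) :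
    finrank ℂ (SK K R M) = finrank ℂ ↥(Gr M ⊓ RK K R) := by
  have hinj : Function.Injective (LinearMap.id.prod M.mulVecLin) :=
    fun x y hxy => congrArg Prod.fst hxy
  rw [SK, Gr, LinearMap.graph_eq_range_prod, ← Submodule.map_comap_eq,
    finrank_map_of_disjoint_ker _ (by rw [LinearMap.ker_eq_bot.mpr hinj]; exact disjoint_bot_right)]

/-- The parametrization `x ↦ (x, γ x)` of the graph of `γ`. -/
def graphMap (γ : Matrix (Fin n ⊕ Fin n) (Fin n ⊕ Fin n) ℂ) :
    (Fin n ⊕ Fin n → ℂ) →ₗ[ℂ] (Fin n ⊕ Fin n → ℂ) × (Fin n ⊕ Fin n → ℂ) :=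
  LinearMap.id.prod γ.mulVecLin

theorem range_graphMap (γ : Matrix (Fin n ⊕ Fin n) (Fin n ⊕ Fin n) ℂ) :
    LinearMap.range (graphMap γ) = Gr γ := by
  rw [Gr, LinearMap.graph_eq_range_prod]
  rfl

theorem graphMap_injective (γ : Matrix (Fin n ⊕ Fin n) (Fin n ⊕ Fin n) ℂ) :
    Function.Injective (graphMap γ) := fun _ _ hxy => congrArg Prod.fst hxy

variable {A B D : Matrix (Fin n) (Fin n) ℂ}

theorem oddPart_graphMap (x : Fin n ⊕ Fin n → ℂ) :
    oddPart n (graphMap (fromBlocks A 0 B D) x) = (x ∘ Sum.inl, A *ᵥ (x ∘ Sum.inl)) := by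
  rw [oddPart_apply]
  refine Prod.ext rfl ?_
  change (fromBlocks A 0 B D *ᵥ x) ∘ Sum.inl = _
  rw [fromBlocks_mulVec]
  simp

theorem evenPart_graphMap (x : Fin n ⊕ Fin n → ℂ) :
    evenPart n (graphMap (fromBlocks A 0 B D) x)
      = (x ∘ Sum.inr, B *ᵥ (x ∘ Sum.inl) + D *ᵥ (x ∘ Sum.inr)) := by
  rw [evenPart_apply]
  refine Prod.ext rfl ?_
  change (fromBlocks A 0 B D *ᵥ x) ∘ Sum.inr = _
  rw [fromBlocks_mulVec]
  simp

/-- The mixed terms cancel because `Dᴴ K A = K`. -/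
theorem pairForm_graphMap (hD : Dᴴ * K * A = K) (x y : Fin n ⊕ Fin n → ℂ) :
    pairForm K (oddPart n (graphMap (fromBlocks A 0 B D) x))
        (evenPart n (graphMap (fromBlocks A 0 B D) y))
      = -star (form (Aᴴ * Kᴴ * B) (y ∘ Sum.inl) (x ∘ Sum.inl)) := by
  rw [oddPart_graphMap, evenPart_graphMap, pairForm_apply]
  dsimp only
  rw [map_add, star_form]
  simp only [form_mulVec_left, form_mulVec_right, conjTranspose_mul, conjTranspose_conjTranspose,
    ← mul_assoc, hD]
  ring

theorem graphMap_isotropic (hD : Dᴴ * K * A = K) (hQ : (Aᴴ * Kᴴ * B).IsHermitian)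
    (x y : Fin n ⊕ Fin n → ℂ) :
    graphForm (JK K) (graphMap (fromBlocks A 0 B D) x) (graphMap (fromBlocks A 0 B D) y) = 0 := by
  rw [graphForm_JK, pairForm_graphMap hD, pairForm_graphMap hD, star_neg, star_star, star_form,
    hQ.eq]
  ring

theorem Gr_inf_ker_oddPart :
    Gr (fromBlocks A 0 B D) ⊓ LinearMap.ker (oddPart n)
      = (LinearMap.ker (LinearMap.funLeft ℂ ℂ (Sum.inl : Fin n → Fin n ⊕ Fin n))).map
        (graphMap (fromBlocks A 0 B D)) := by
  rw [← range_graphMap]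
  ext z
  constructor
  · rintro ⟨⟨x, rfl⟩, hx⟩
    have h1 : oddPart n (graphMap (fromBlocks A 0 B D) x) = 0 := hx
    exact ⟨x, congrArg Prod.fst h1, rfl⟩
  · rintro ⟨x, hx, rfl⟩
    have h1 : x ∘ Sum.inl = 0 := hx
    refine ⟨⟨x, rfl⟩, ?_⟩
    rw [SetLike.mem_coe, LinearMap.mem_ker, oddPart_graphMap, h1, mulVec_zero]
    rfl

theorem finrank_Gr_inf_ker_oddPart :
    finrank ℂ ↥(Gr (fromBlocks A 0 B D) ⊓ LinearMap.ker (oddPart n))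
      = finrank ℂ (LinearMap.ker (LinearMap.funLeft ℂ ℂ (Sum.inl : Fin n → Fin n ⊕ Fin n))) := by
  rw [Gr_inf_ker_oddPart, finrank_map_of_disjoint_ker _ (by
    rw [LinearMap.ker_eq_bot.mpr (graphMap_injective _)]
    exact disjoint_bot_right)]

theorem finrank_Gr_inf_WK_inf_ker :
    finrank ℂ ↥(Gr (fromBlocks A 0 B D) ⊓ WK K R ⊓ LinearMap.ker (oddPart n))
      = finrank ℂ ↥(Gr D ⊓ R) := by
  rw [← finrank_map_of_disjoint_ker (evenPart n) (disjoint_ker_parts inf_le_right),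
    ← range_graphMap]
  suffices h : ((LinearMap.range (graphMap (fromBlocks A 0 B D)) ⊓ WK K R ⊓
      LinearMap.ker (oddPart n)).map (evenPart n)) = Gr D ⊓ R by rw [h]
  ext v
  constructor
  · rintro ⟨_, ⟨⟨⟨x, rfl⟩, hxW⟩, hxF⟩, rfl⟩
    have h1 : oddPart n (graphMap (fromBlocks A 0 B D) x) = 0 := hxF
    have h2 : x ∘ Sum.inl = 0 := congrArg Prod.fst h1
    refine ⟨?_, hxW.2⟩
    rw [evenPart_graphMap, h2]
    simp [Gr]
  · rintro ⟨hv, hvR⟩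
    have hv' : v.2 = D *ᵥ v.1 := by
      rwa [SetLike.mem_coe, Gr, LinearMap.mem_graph_iff, mulVecLin_apply] at hv
    have h1 : oddPart n (graphMap (fromBlocks A 0 B D) (Sum.elim 0 v.1)) = 0 := by
      rw [oddPart_graphMap, Sum.elim_comp_inl, mulVec_zero]
      rfl
    have h2 : evenPart n (graphMap (fromBlocks A 0 B D) (Sum.elim 0 v.1)) = v := by
      rw [evenPart_graphMap, Sum.elim_comp_inl, Sum.elim_comp_inr, mulVec_zero, zero_add, ← hv']
    exact ⟨_, ⟨⟨⟨_, rfl⟩, mem_WK_iff.mpr ⟨h1 ▸ Submodule.zero_mem _, h2.symm ▸ hvR⟩⟩, h1⟩, h2⟩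

variable (n) in
/-- The projection `(x₁, x₂, x₃, x₄) ↦ x₁`. -/
def firstPart : ((Fin n ⊕ Fin n → ℂ) × (Fin n ⊕ Fin n → ℂ)) →ₗ[ℂ] (Fin n → ℂ) :=
  LinearMap.fst ℂ _ _ ∘ₗ oddPart n

theorem firstPart_graphMap (γ : Matrix (Fin n ⊕ Fin n) (Fin n ⊕ Fin n) ℂ)
    (x : Fin n ⊕ Fin n → ℂ) : firstPart n (graphMap γ x) = x ∘ Sum.inl := rfl

/-- The first coordinates of the vectors of `Gr γ ∩ W_K(R)` are the kernel of the form on `S`. -/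
theorem map_Gr_inf_WK (hK : IsUnit K) (hD : Dᴴ * K * A = K) :
    (Gr (fromBlocks A 0 B D) ⊓ WK K R).map (firstPart n)
      = formKer (Aᴴ * Kᴴ * B) (SK K R A) := by
  rw [← range_graphMap]
  ext v
  constructor
  · rintro ⟨_, ⟨⟨x, rfl⟩, hxW⟩, rfl⟩
    rw [firstPart_graphMap]
    have h1 : oddPart n (graphMap (fromBlocks A 0 B D) x) ∈ RK K R := hxW.1
    rw [oddPart_graphMap] at h1
    refine ⟨h1, fun y hy => ?_⟩
    have h2 := pairForm_graphMap (B := B) hD (Sum.elim y 0) x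
    have h3 : oddPart n (graphMap (fromBlocks A 0 B D) (Sum.elim y 0)) ∈ RK K R := by
      rw [oddPart_graphMap]
      exact hy
    have h4 : pairForm K (oddPart n (graphMap (fromBlocks A 0 B D) (Sum.elim y 0)))
        (evenPart n (graphMap (fromBlocks A 0 B D) x)) = 0 := h3 _ hxW.2
    rw [h4, Sum.elim_comp_inl] at h2
    exact star_eq_zero.mp (neg_eq_zero.mp h2.symm)
  · rintro ⟨hvS, hv⟩
    have h1 : ((0 : Fin n → ℂ), B *ᵥ v) ∈ R ⊔ Gr D := by
      apply mem_of_perp (h := pairForm K) fun y => pairForm_right hK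
      rw [perp_sup_Gr hK hD]
      rintro ⟨u₁, u₂⟩ ⟨hu, hu'⟩
      have hu2 : u₂ = A *ᵥ u₁ := by
        rwa [SetLike.mem_coe, Gr, LinearMap.mem_graph_iff, mulVecLin_apply] at hu'
      subst hu2
      have h2 := hv u₁ hu
      have h3 := congrArg star h2
      rw [star_form] at h3
      rw [pairForm_apply, form_mulVec_left, form_mulVec_right, map_zero, zero_sub]
      simpa [← mul_assoc] using h3
    obtain ⟨r, hr, g, hg, hsum⟩ := Submodule.mem_sup.mp h1
    have hg' : g.2 = D *ᵥ g.1 := by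
      rwa [Gr, LinearMap.mem_graph_iff, mulVecLin_apply] at hg
    have h2 : r.1 + g.1 = 0 := congrArg Prod.fst hsum
    have h3 : r.2 + g.2 = B *ᵥ v := congrArg Prod.snd hsum
    refine ⟨_, ⟨⟨Sum.elim v r.1, rfl⟩, mem_WK_iff.mpr ⟨?_, ?_⟩⟩, ?_⟩
    · rw [oddPart_graphMap, Sum.elim_comp_inl]
      exact hvS
    · rw [evenPart_graphMap, Sum.elim_comp_inl, Sum.elim_comp_inr, ← h3, hg',
        eq_neg_of_add_eq_zero_right h2, mulVec_neg, neg_add_cancel_right]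
      exact hr
    · rw [firstPart_graphMap, Sum.elim_comp_inl]

/-- The kernel of the projection of `Gr γ ∩ W_K(R)` to the first coordinate is the part with
vanishing odd coordinates. -/
theorem finrank_Gr_inf_WK (hK : IsUnit K) (hD : Dᴴ * K * A = K) :
    finrank ℂ ↥(Gr (fromBlocks A 0 B D) ⊓ WK K R)
      = finrank ℂ (formKer (Aᴴ * Kᴴ * B) (SK K R A)) + finrank ℂ ↥(Gr D ⊓ R) := by
  have h1 := finrank_map_add_finrank_inf_ker (firstPart n) (Gr (fromBlocks A 0 B D) ⊓ WK K R)
  have h2 : Gr (fromBlocks A 0 B D) ⊓ WK K R ⊓ LinearMap.ker (firstPart n)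
      = Gr (fromBlocks A 0 B D) ⊓ WK K R ⊓ LinearMap.ker (oddPart n) := by
    ext z
    constructor
    · rintro ⟨⟨hz, hzW⟩, hz0⟩
      refine ⟨⟨hz, hzW⟩, ?_⟩
      rw [← range_graphMap] at hz
      obtain ⟨x, rfl⟩ := hz
      have h3 : x ∘ Sum.inl = 0 := hz0
      rw [SetLike.mem_coe, LinearMap.mem_ker, oddPart_graphMap, h3, mulVec_zero]
      rfl
    · rintro ⟨hz, hz0⟩
      exact ⟨hz, congrArg Prod.fst (LinearMap.mem_ker.mp hz0)⟩
  rw [h2, map_Gr_inf_WK hK hD, finrank_Gr_inf_WK_inf_ker] at h1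
  exact h1.symm

/-- `S` is the space of first coordinates of `Gr γ ∩ (W_K(R) + F)`, where `F` is the subspace of
vanishing odd coordinates. -/
theorem map_Gr_inf_sup :
    (Gr (fromBlocks A 0 B D) ⊓ (WK K R ⊔ LinearMap.ker (oddPart n))).map (firstPart n)
      = SK K R A := by
  rw [← range_graphMap]
  ext v
  constructor
  · rintro ⟨_, ⟨⟨x, rfl⟩, hx⟩, rfl⟩
    obtain ⟨w, hw, f, hf, hsum⟩ := Submodule.mem_sup.mp hx
    have h1 := congrArg (oddPart n) hsum
    rw [map_add, LinearMap.mem_ker.mp hf, add_zero, oddPart_graphMap] at h1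
    have h2 : oddPart n w ∈ RK K R := hw.1
    rw [h1] at h2
    exact h2
  · intro hv
    refine ⟨_, ⟨⟨Sum.elim v 0, rfl⟩, ?_⟩, by rw [firstPart_graphMap, Sum.elim_comp_inl]⟩
    set z := graphMap (fromBlocks A 0 B D) (Sum.elim v 0)
    obtain ⟨w, hw1, hw2⟩ := exists_parts (oddPart n z) 0
    have hwW : w ∈ WK K R := by
      refine mem_WK_iff.mpr ⟨?_, hw2 ▸ R.zero_mem⟩
      rw [hw1, oddPart_graphMap, Sum.elim_comp_inl]
      exact hv
    have hf : z - w ∈ LinearMap.ker (oddPart n) := by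
      rw [LinearMap.mem_ker, map_sub, hw1, sub_self]
    have := Submodule.add_mem_sup hwW hf
    rwa [add_sub_cancel] at this

/-- The form of `posIndex_sectionForm` on `Gr γ ∩ (W_K(R) + F)` is the form of
`M₁₁ᴴ Kᴴ M₂₁` on `S`. -/
theorem graphForm_eq_form (hD : Dᴴ * K * A = K) {w f : (Fin n ⊕ Fin n → ℂ) × (Fin n ⊕ Fin n → ℂ)}
    (hw : w ∈ WK K R) (hf : f ∈ LinearMap.ker (oddPart n))
    (hwf : w + f ∈ Gr (fromBlocks A 0 B D)) :
    (graphForm (JK K) w f).re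
      = (form (Aᴴ * Kᴴ * B) (firstPart n (w + f)) (firstPart n (w + f))).re := by
  rw [← range_graphMap] at hwf
  obtain ⟨x, hx⟩ := hwf
  have hf0 : oddPart n f = 0 := hf
  have h1 : oddPart n w = oddPart n (w + f) := by rw [map_add, hf0, add_zero]
  have h2 : evenPart n f = evenPart n (w + f) - evenPart n w := by rw [map_add, add_sub_cancel_left]
  have h3 : pairForm K (oddPart n (w + f)) (evenPart n w) = 0 := by
    rw [← h1]
    exact hw.1 _ hw.2
  rw [graphForm_JK, hf0, h1, h2, map_sub, h3, ← hx, pairForm_graphMap hD, firstPart_graphMap]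
  simp

end BoundaryConditions

theorem theorem2p2 (n : ℕ) (K : Matrix (Fin n) (Fin n) ℂ) (hK : IsUnit K)
    (T : ℝ) (hT : 0 < T)
    (M₁₁ M₂₁ M₂₂ : ℝ → Matrix (Fin n) (Fin n) ℂ)
    (hc₁₁ : ContinuousOn M₁₁ (Set.Icc 0 T))
    (hc₂₁ : ContinuousOn M₂₁ (Set.Icc 0 T))
    (hc₂₂ : ContinuousOn M₂₂ (Set.Icc 0 T))
    (hK₁₁ : ∀ t ∈ Set.Icc 0 T, (M₂₂ t).conjTranspose * K * M₁₁ t = K)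
    (hsa : ∀ t ∈ Set.Icc 0 T,
      ((M₁₁ t).conjTranspose * K.conjTranspose * M₂₁ t).IsHermitian)
    (R : Submodule ℂ ((Fin n → ℂ) × (Fin n → ℂ)))
    (γ : ℝ → Matrix (Fin n ⊕ Fin n) (Fin n ⊕ Fin n) ℂ)
    (hγ : ∀ t, γ t = Matrix.fromBlocks (M₁₁ t) 0 (M₂₁ t) (M₂₂ t))
    (S : ℝ → Submodule ℂ (Fin n → ℂ)) (hS : ∀ t, S t = SK K R (M₁₁ t))
    (Q : ℝ → Matrix (Fin n) (Fin n) ℂ)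
    (hQ : ∀ t, Q t = (M₁₁ t).conjTranspose * K.conjTranspose * M₂₁ t) :
    (∀ t ∈ Set.Icc 0 T,
      (Module.finrank ℂ ↥(Gr (γ t) ⊓ WK K R) : ℤ)
        = Module.finrank ℂ (formKer (Q t) (S t)) + Module.finrank ℂ (S t)
          + Module.finrank ℂ ↥(Gr (1 : Matrix (Fin n) (Fin n) ℂ) ⊓ R)
          - Module.finrank ℂ ↥(Gr (1 : Matrix (Fin n) (Fin n) ℂ) ⊓ RK K R)) ∧
    (∀ k : ℤ, HasMaslovTypeIndex (JK K) (WK K R) 0 T γ k ↔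
      k = morsePos (Q T) (S T) - morsePos (Q 0) (S 0)
        + Module.finrank ℂ (S 0) - Module.finrank ℂ (S T)) := by
  have hdim : ∀ t ∈ Set.Icc 0 T, Module.finrank ℂ ↥(Gr (M₂₂ t) ⊓ R)
      + Module.finrank ℂ (RK K R) = n + Module.finrank ℂ (S t) := fun t ht => by
    rw [hS, finrank_SK, finrank_Gr_inf hK (hK₁₁ t ht)]
  refine ⟨fun t ht => ?_, fun k => ?_⟩
  · have h1 := hdim t ht
    have h2 := finrank_Gr_inf (R := R) hK
      (show (1 : Matrix (Fin n) (Fin n) ℂ).conjTranspose * K * 1 = K by simp)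
    rw [hγ, finrank_Gr_inf_WK hK (hK₁₁ t ht), hQ, ← hS]
    push_cast
    omega
  · have hcγ : ContinuousOn γ (Set.Icc 0 T) := by
      simp_rw [funext hγ]
      rw [continuousOn_iff_continuous_domRestrict] at hc₁₁ hc₂₁ hc₂₂ ⊢
      exact Continuous.matrix_fromBlocks hc₁₁ continuous_const hc₂₁ hc₂₂
    have main := hasMaslovIndex_iff (ω := graphForm (JK K)) (W := WK K R)
      (F := LinearMap.ker (oddPart n)) (j := fun t => graphMap (γ t)) (q := fun t => form (Q t))
      (S := S) isSkewHerm_graphForm (graphForm_nondegenerate hK) (by simp; ring) hT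
      (fun t => graphMap_injective _)
      (fun x f => by
        refine (LinearMap.continuous_of_finiteDimensional f).comp_continuousOn ?_
        refine continuousOn_const.prodMk ?_
        rw [continuousOn_iff_continuous_domRestrict] at hcγ ⊢
        exact hcγ.matrix_mulVec continuous_const)
      (fun t ht x y => by
        rw [hγ]
        exact graphMap_isotropic (hK₁₁ t ht) (hsa t ht) x y)
      WK_isotropic (by rw [finrank_WK hK]; simp; ring) (perp_ker_oddPart hK)
      (fun t => by rw [range_graphMap, hγ]; exact finrank_Gr_inf_ker_oddPart) (firstPart n)
      (fun t _ => by rw [range_graphMap, hγ, hS]; exact map_Gr_inf_sup)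
      (fun t ht w hw f hf hwf => by
        rw [range_graphMap, hγ] at hwf
        rw [hQ]
        exact graphForm_eq_form (hK₁₁ t ht) hw hf hwf) k
    simp only [range_graphMap] at main
    rw [range_graphMap (γ T), range_graphMap (γ 0)] at main
    rw [HasMaslovTypeIndex, main, hγ, hγ, finrank_Gr_inf_WK_inf_ker, finrank_Gr_inf_WK_inf_ker]
    have h0 := hdim 0 (Set.left_mem_Icc.mpr hT.le)
    have h1 := hdim T (Set.right_mem_Icc.mpr hT.le)
    rw [show ∀ A : Matrix (Fin n) (Fin n) ℂ, ∀ S, morsePos A S = posIndex (form A) S from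
      fun _ _ => rfl, show ∀ A : Matrix (Fin n) (Fin n) ℂ, ∀ S,
      morsePos A S = posIndex (form A) S from fun _ _ => rfl]
    omega
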